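/- Let $G=(V,E)$ be an infinite, connected simple graph of bounded degree, and let $\mathbb{G}=(\mathbb{V},\mathbb{E})$ be its Cartesian product with $\mathbb{Z}$: $\mathbb{V}=V\times\mathbb{Z}$, with edges $\langle (u,n),(v,n)\rangle$ for $\langle u,v\rangle\in E$, $n\in\mathbb{Z}$, and $\langle (w,n),(w,n+1)\rangle$ for $w\in V$, $n\in\mathbb{Z}$. Let $G^{(r)}=(U^{(r)},E^{(r)})$, $r\in\mathbb{N}$, be finite connected (in particular non-empty) subgraphs of $G$ such that $\operatorname{dist}_G(U^{(i)},U^{(j)})\ge 3$ for all $i\ne j$ and $\sup_{r}|U^{(r)}|<\infty$. For $q,p\in[0,1]$ let $\mathbb{P}_{q,p}$ be the law of the bond percolation configuration on $\mathbb{G}$ (an element of $\{0,1\}^{\mathbb{E}}$ with the product $\sigma$-algebra) in which all edges are independent, each edge of the form $\langle (u,n),(v,n)\rangle$ with $\langle u,v\rangle\in E^{(r)}$ or $\langle (w,n),(w,n+1)\rangle$ with $w\in U^{(r)}$, for some $r\in\mathbb{N}$ and $n\in\mathbb{Z}$, is open with probability $q$, and every other edge is open with probability $p$. Write $(v,0)\leftrightarrow\infty$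 for the event that infinitely many vertices can be reached from $(v,0)$ by open paths. Fix $p,q\in(0,1)$ and $\varepsilon\in(0,\min(p,1-p))$. Then there is $\eta>0$ such that for every $\delta\in(0,\eta)$ one has $q-\delta,\,q+\delta\in[0,1]$ and $$\mathbb{P}_{q+\delta,\,p-\varepsilon}\bigl((v,0)\leftrightarrow\infty\bigr)\le \mathbb{P}_{q-\delta,\,p+\varepsilon}\bigl((v,0)\leftrightarrow\infty\bigr)\qquad\text{for every } v\in V\setminus\bigcup_{r\in\mathbb{N}}U^{(r)}.$$ -/

import Mathlib

open MeasureTheory ProbabilityTheory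
open scoped unitInterval

namespace LadderPercolation

/-- The graph distance between two sets of vertices: the infimum of the lengths of walks
joining a vertex of `A` to a vertex of `B`. -/
noncomputable def setDist {V : Type*} (G : SimpleGraph V) (A B : Set V) : ℕ∞ :=
  ⨅ a ∈ A, ⨅ b ∈ B, G.edist a b

/-- `G` has bounded degree. -/
def BoundedDegree {V : Type*} (G : SimpleGraph V) : Prop :=
  ∃ D : ℕ, ∀ v : V, (G.neighborSet v).encard ≤ D

/-- The Cartesian product of `G` with the integers, where consecutive integers are adjacent. -/
noncomputable def ladder {V : Type*} (G : SimpleGraph V) : SimpleGraph (V × ℤ) :=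
  SimpleGraph.boxProd G (SimpleGraph.hasse ℤ)

/-- The edges of `ladder G` which project into the subgraph `H`: the horizontal edges above
edges of `H`, and the vertical edges above vertices of `H`. -/
def inEdges {V : Type*} {G : SimpleGraph V} (H : G.Subgraph) : Set (Sym2 (V × ℤ)) :=
  {e | ∃ (u v : V) (n : ℤ), H.Adj u v ∧ e = s((u, n), (v, n))} ∪
    {e | ∃ (w : V) (n : ℤ), w ∈ H.verts ∧ e = s((w, n), (w, n + 1))}

/-- A percolation configuration: every edge of `ladder G` is open (`true`) or closed (`false`). -/
abbrev Config {V : Type*} (G : SimpleGraph V) : Type _ := (ladder G).edgeSet → Bool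

open Classical in
/-- The probability that an edge is open: `q` if its projection lies in one of the subgraphs
`H r`, and `p` otherwise. -/
noncomputable def edgeParam {V : Type*} {G : SimpleGraph V} (H : ℕ → G.Subgraph) (q p : I)
    (e : (ladder G).edgeSet) : I :=
  if (e : Sym2 (V × ℤ)) ∈ ⋃ r, inEdges (H r) then q else p

/-- The law of the configuration in which the edges are open independently of each other with
the probabilities `edgeParam H q p`, on the product (cylinder) σ-algebra. -/
noncomputable def percLaw {V : Type*} {G : SimpleGraph V} (H : ℕ → G.Subgraph) (q p : I) :
    Measure (Config G) :=
  Measure.infinitePi fun e => bernoulliMeasure true false (edgeParam H q p e)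

/-- The graph formed by the open edges of the configuration `ω`. -/
def openGraph {V : Type*} {G : SimpleGraph V} (ω : Config G) : SimpleGraph (V × ℤ) :=
  SimpleGraph.fromEdgeSet {e | ∃ h : e ∈ (ladder G).edgeSet, ω ⟨e, h⟩ = true}

/-- The cluster of `x`: the vertices that can be reached from `x` by an open path. -/
def cluster {V : Type*} {G : SimpleGraph V} (ω : Config G) (x : V × ℤ) : Set (V × ℤ) :=
  {y | (openGraph ω).Reachable x y}

/-- The event that the cluster of `x` is infinite. -/
def percolates {V : Type*} (G : SimpleGraph V) (x : V × ℤ) : Set (Config G) :=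
  {ω | (cluster ω x).Infinite}

end LadderPercolation

/-! Percolation from `(v, 0)` is the decreasing limit of the events of leaving finite cylinders
(`percolates_eq_iInter`), so it suffices to compare escape probabilities with an `η` that does not
depend on the cylinder (`percLaw_escapes_le`). Such an event is increasing and depends on finitely
many edges. Move the parameters linearly from `(q + δ, p - ε)` to `(q - δ, p + ε)`. By Russo's
formula the derivative is `ε` times the total influence of the outer edges minus `δ` times that of
the inner ones, where inner means projecting into some `H r`. It is nonnegative once the inner
influence is at most a constant times the outer influence and `δ` is small
(`cfgProb_le_of_transfer`).

That bound comes from local surgery (`exists_outer_decisive_edge`). Around a pivotal inner edge take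
a box of two levels above `H r` and its neighbours. With the box closed there is no escape; with the
box open there is. If opening all inner edges of the box is not enough, open its outer edges one at
a time: one of them is decisive. Otherwise inner edges join the cluster of the origin, at some `a`,
to a vertex `b` that escapes. Instead, lead `a` and `b` by disjoint inner connections to the two
levels above one vertex `u₀` of `H r` (`separable_of_ne`), and complete the link by an outer detour
through a neighbour of `u₀` outside `H r`; again some outer edge is decisive. Boxes have bounded
size and bounded overlap, so each surgery costs a bounded factor. -/

namespace LadderPercolation

/-! ### Influences in finite products of Bernoulli laws. -/

section FiniteProduct

open Function

/-- The mass of a value under a Bernoulli law with parameter `a`. -/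
def bernWeight (a : ℝ) (b : Bool) : ℝ := cond b a (1 - a)

variable {α : Type*} [Fintype α] [DecidableEq α]

/-- The mass of a configuration under the product of Bernoulli laws. -/
def cfgWeight (x : α → ℝ) (ω : α → Bool) : ℝ := ∏ e, bernWeight (x e) (ω e)

open Classical in
/-- The probability of an event under the product of Bernoulli laws. -/
noncomputable def cfgProb (x : α → ℝ) (A : Set (α → Bool)) : ℝ :=
  ∑ ω, if ω ∈ A then cfgWeight x ω else 0

/-- The event that the state of `e` decides whether `A` occurs. -/
def pivotal (A : Set (α → Bool)) (e : α) : Set (α → Bool) :=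
  {ω | update ω e true ∈ A ∧ update ω e false ∉ A}

omit [Fintype α] [DecidableEq α] in
lemma bernWeight_mem {c a : ℝ} (h : a ∈ Set.Icc c (1 - c)) (b : Bool) :
    bernWeight a b ∈ Set.Icc c (1 - c) := by
  obtain ⟨h1, h2⟩ := h
  cases b <;> simp only [bernWeight, cond_true, cond_false, Set.mem_Icc] <;> constructor <;> linarith

omit [DecidableEq α] in
lemma cfgWeight_nonneg {c : ℝ} (hc : 0 < c) {x : α → ℝ} (hx : ∀ e, x e ∈ Set.Icc c (1 - c))
    (ω : α → Bool) : 0 ≤ cfgWeight x ω :=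
  Finset.prod_nonneg fun e _ => hc.le.trans (bernWeight_mem (hx e) _).1

lemma cfgProb_nonneg {c : ℝ} (hc : 0 < c) {x : α → ℝ} (hx : ∀ e, x e ∈ Set.Icc c (1 - c))
    (A : Set (α → Bool)) : 0 ≤ cfgProb x A := by
  classical
  refine Finset.sum_nonneg fun ω _ => ?_
  split_ifs
  · exact cfgWeight_nonneg hc hx ω
  · exact le_rfl

/-- Configurations are paired by flipping `e`; the weights of the two states add up to 1, so `a` is
arbitrary. -/
lemma sum_eq_sum_bernWeight_update (φ : (α → Bool) → ℝ) (e : α) (a : ℝ) :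
    ∑ ω, φ ω = ∑ ω : α → Bool,
      bernWeight a (ω e) * (φ (update ω e true) + φ (update ω e false)) := by
  have key : ∀ ψ : (α → Bool) → ℝ, ∑ ω, ψ ω =
      ∑ ω' : {j // j ≠ e} → Bool, (ψ ((Equiv.funSplitAt e Bool).symm (true, ω')) +
        ψ ((Equiv.funSplitAt e Bool).symm (false, ω'))) := by
    intro ψ
    rw [← (Equiv.funSplitAt e Bool).symm.sum_comp, Fintype.sum_prod_type_right]
    simp
  have hup : ∀ (b b' : Bool) (ω' : {j // j ≠ e} → Bool),
      update ((Equiv.funSplitAt e Bool).symm (b, ω')) e b' =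
        (Equiv.funSplitAt e Bool).symm (b', ω') := by
    intro b b' ω'
    ext j
    by_cases h : j = e
    · subst h; simp [Equiv.funSplitAt, Equiv.piSplitAt]
    · simp [h, Equiv.funSplitAt, Equiv.piSplitAt]
  have hat : ∀ (b : Bool) (ω' : {j // j ≠ e} → Bool),
      (Equiv.funSplitAt e Bool).symm (b, ω') e = b := by
    intro b ω'
    simp [Equiv.funSplitAt, Equiv.piSplitAt]
  rw [key, key]
  refine Finset.sum_congr rfl fun ω' _ => ?_
  simp only [hup, hat, bernWeight, cond_true, cond_false]
  ring

lemma cfgWeight_eq_mul_erase (x : α → ℝ) (ω : α → Bool) (e : α) :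
    cfgWeight x ω = bernWeight (x e) (ω e) *
      ∏ j ∈ Finset.univ.erase e, bernWeight (x j) (ω j) :=
  (Finset.mul_prod_erase _ _ (Finset.mem_univ e)).symm

/-- Russo's formula. -/
lemma hasDerivAt_cfgProb {A : Set (α → Bool)} (hA : IsUpperSet A) {x : ℝ → α → ℝ} {x' : α → ℝ}
    {t : ℝ} (hx : ∀ e, HasDerivAt (fun s => x s e) (x' e) t) :
    HasDerivAt (fun s => cfgProb (x s) A) (∑ e, x' e * cfgProb (x t) (pivotal A e)) t := by
  classical
  have hb : ∀ (e : α) (b : Bool),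
      HasDerivAt (fun s => bernWeight (x s e) b) (x' e * cond b 1 (-1)) t := by
    intro e b
    cases b
    · simpa [bernWeight] using (hx e).const_sub 1
    · simpa [bernWeight] using hx e
  have hw : ∀ ω : α → Bool, HasDerivAt (fun s => if ω ∈ A then cfgWeight (x s) ω else 0)
      (∑ e, x' e * (if ω ∈ A then (cond (ω e) 1 (-1)) *
        ∏ j ∈ Finset.univ.erase e, bernWeight (x t j) (ω j) else 0)) t := by
    intro ω
    by_cases h : ω ∈ A
    · simp only [h, if_true]
      have := HasDerivAt.fun_finsetProd (u := Finset.univ) (x := t)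
        (f := fun e s => bernWeight (x s e) (ω e)) (fun e _ => hb e (ω e))
      refine this.congr_deriv (Finset.sum_congr rfl fun e _ => ?_)
      simp only [smul_eq_mul]
      ring
    · simpa [h] using hasDerivAt_const t (0 : ℝ)
  have hs := HasDerivAt.fun_sum (u := (Finset.univ : Finset (α → Bool))) fun ω _ => hw ω
  refine hs.congr_deriv ?_
  rw [Finset.sum_comm]
  refine Finset.sum_congr rfl fun e _ => ?_
  rw [← Finset.mul_sum]
  congr 1
  -- Differentiation removed the factor of `e`; averaging over its state restores it. The signs `1`
  -- and `-1` then cancel unless `e` is pivotal, and the two sides agree term by term.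
  rw [sum_eq_sum_bernWeight_update _ e (x t e)]
  refine Finset.sum_congr rfl fun ω _ => ?_
  have hprod : ∀ b, ∏ j ∈ Finset.univ.erase e, bernWeight (x t j) (update ω e b j) =
      ∏ j ∈ Finset.univ.erase e, bernWeight (x t j) (ω j) := by
    intro b
    refine Finset.prod_congr rfl fun j hj => ?_
    rw [update_of_ne (Finset.ne_of_mem_erase hj)]
  have hle : update ω e false ∈ A → update ω e true ∈ A := by
    refine fun h => hA ?_ h
    simp
  rw [hprod, hprod, cfgWeight_eq_mul_erase _ _ e]
  by_cases h1 : update ω e true ∈ A <;> by_cases h2 : update ω e false ∈ A <;>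
    (simp [pivotal, h1, h2]; try tauto)

/-- The configurations which agree with `ω'` off a set of size at most `M` are at most `2 ^ M`. -/
lemma card_eqOn_compl_le (ω' : α → Bool) (B : Finset α) {M : ℕ} (hB : B.card ≤ M) :
    (Finset.univ.filter fun ω : α → Bool => ∀ j ∉ B, ω' j = ω j).card ≤ 2 ^ M := by
  calc _ ≤ (Finset.univ : Finset (B → Bool)).card := by
        refine Finset.card_le_card_of_injOn (fun ω j => ω j) (fun _ _ => Finset.mem_coe.2 (Finset.mem_univ _)) ?_
        intro ω₁ h₁ ω₂ h₂ h
        simp only [Finset.coe_filter, Finset.mem_univ, true_and, Set.mem_ofPred_eq] at h₁ h₂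
        ext j
        by_cases hj : j ∈ B
        · rw [show ω₁ j = ω₂ j from congrFun h ⟨j, hj⟩]
        · rw [← h₁ j hj, ← h₂ j hj]
    _ = 2 ^ B.card := by simp
    _ ≤ 2 ^ M := Nat.pow_le_pow_right (by norm_num) hB

/-- Only the factors in `B` differ: those of `ω` are at most 1, those of `ω'` at least `c`. -/
lemma cfgWeight_mul_pow_le {c : ℝ} (hc : 0 < c) (hc1 : c ≤ 1) {x : α → ℝ} (hx : ∀ e, x e ∈ Set.Icc c (1 - c))
    {ω ω' : α → Bool} {B : Finset α} {M : ℕ} (hB : B.card ≤ M) (h : ∀ j ∉ B, ω' j = ω j) :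
    c ^ M * cfgWeight x ω ≤ cfgWeight x ω' := by
  have hpos : ∀ (ω : α → Bool) j, 0 ≤ bernWeight (x j) (ω j) :=
    fun ω j => hc.le.trans (bernWeight_mem (hx j) _).1
  have hone : ∀ (ω : α → Bool) j, bernWeight (x j) (ω j) ≤ 1 :=
    fun ω j => (bernWeight_mem (hx j) _).2.trans (by linarith)
  have hsplit : ∀ ω : α → Bool, cfgWeight x ω =
      (∏ j ∈ B, bernWeight (x j) (ω j)) * ∏ j ∈ Bᶜ, bernWeight (x j) (ω j) :=
    fun ω => (Finset.prod_mul_prod_compl B _).symm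
  rw [hsplit, hsplit]
  have h1 : ∏ j ∈ Bᶜ, bernWeight (x j) (ω' j) = ∏ j ∈ Bᶜ, bernWeight (x j) (ω j) :=
    Finset.prod_congr rfl fun j hj => by rw [h j (Finset.mem_compl.1 hj)]
  have h2 : c ^ M ≤ ∏ j ∈ B, bernWeight (x j) (ω' j) := by
    calc c ^ M ≤ c ^ B.card := pow_le_pow_of_le_one hc.le hc1 hB
      _ = ∏ _j ∈ B, c := by simp
      _ ≤ _ := Finset.prod_le_prod (fun _ _ => hc.le) fun j _ => (bernWeight_mem (hx j) _).1
  have h3 : ∏ j ∈ B, bernWeight (x j) (ω j) ≤ 1 :=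
    Finset.prod_le_one (fun j _ => hpos ω j) fun j _ => hone ω j
  rw [h1, ← mul_assoc]
  refine mul_le_mul_of_nonneg_right ?_ (Finset.prod_nonneg fun j _ => hpos ω j)
  calc _ ≤ c ^ M * 1 := mul_le_mul_of_nonneg_left h3 (by positivity)
    _ ≤ _ := by rw [mul_one]; exact h2

-- A many-to-one charging argument: each `ω` is charged to some pair `(f, ω')`, and each `ω'` is
-- related to at most `K` configurations `ω`.
open Classical in
lemma sum_le_mul_sum_of_card_le {Ω ι : Type*} [Fintype Ω] {g₀ : Ω → ℝ} {g : ι → Ω → ℝ}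
    (hg : ∀ f ω, 0 ≤ g f ω) {B' : Finset ι} {R : Ω → Ω → Prop} {K : ℝ}
    (hR : ∀ ω', ((Finset.univ.filter fun ω => R ω ω').card : ℝ) ≤ K)
    (h : ∀ ω, g₀ ω ≠ 0 → ∃ f ∈ B', ∃ ω', R ω ω' ∧ g₀ ω ≤ g f ω') :
    ∑ ω, g₀ ω ≤ K * ∑ f ∈ B', ∑ ω, g f ω := by
  have hnn : ∀ (ω : Ω) (f : ι) (ω' : Ω), 0 ≤ if R ω ω' then g f ω' else 0 := by
    intro ω f ω'
    split_ifs
    exacts [hg f ω', le_rfl]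
  have step : ∀ ω, g₀ ω ≤ ∑ f ∈ B', ∑ ω', if R ω ω' then g f ω' else 0 := by
    intro ω
    by_cases hω : g₀ ω = 0
    · rw [hω]
      exact Finset.sum_nonneg fun f _ => Finset.sum_nonneg fun ω' _ => hnn ω f ω'
    · obtain ⟨f, hf, ω', hj, hle⟩ := h ω hω
      refine le_trans ?_
        (Finset.single_le_sum (fun f _ => Finset.sum_nonneg fun ω' _ => hnn ω f ω') hf)
      refine le_trans ?_ (Finset.single_le_sum (fun ω' _ => hnn ω f ω') (Finset.mem_univ ω'))
      rwa [if_pos hj]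
  calc ∑ ω, g₀ ω
      ≤ ∑ ω, ∑ f ∈ B', ∑ ω', if R ω ω' then g f ω' else 0 :=
        Finset.sum_le_sum fun ω _ => step ω
    _ = ∑ f ∈ B', ∑ ω', ∑ ω, if R ω ω' then g f ω' else 0 := by
        rw [Finset.sum_comm]
        exact Finset.sum_congr rfl fun f _ => Finset.sum_comm
    _ ≤ ∑ f ∈ B', ∑ ω', K * g f ω' := by
        refine Finset.sum_le_sum fun f _ => Finset.sum_le_sum fun ω' _ => ?_
        rw [← Finset.sum_filter, Finset.sum_const, nsmul_eq_mul]
        exact mul_le_mul_of_nonneg_right (hR ω') (hg f ω')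
    _ = K * ∑ f ∈ B', ∑ ω, g f ω := by
        simp only [← Finset.mul_sum]

open Classical in
/-- If every configuration for which `e` is pivotal can be changed inside `B` into one for which an
element of `B'` is pivotal, then the influence of `e` is controlled by those of `B'`. -/
lemma cfgProb_pivotal_le {c : ℝ} (hc : 0 < c) {x : α → ℝ} (hx : ∀ e, x e ∈ Set.Icc c (1 - c))
    {A : Set (α → Bool)} {e : α} {B B' : Finset α} {M : ℕ} (hB : B.card ≤ M)
    (h : ∀ ω ∈ pivotal A e, ∃ f ∈ B', ∃ ω' ∈ pivotal A f, ∀ j ∉ B, ω' j = ω j) :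
    c ^ M * cfgProb x (pivotal A e) ≤ 2 ^ M * ∑ f ∈ B', cfgProb x (pivotal A f) := by
  have hc1 : c ≤ 1 := by linarith [(hx e).1, (hx e).2]
  have hg : ∀ (f : α) (ω : α → Bool), 0 ≤ if ω ∈ pivotal A f then cfgWeight x ω else 0 := by
    intro f ω
    split_ifs
    exacts [cfgWeight_nonneg hc hx ω, le_rfl]
  have key := sum_le_mul_sum_of_card_le (K := 2 ^ M) (B' := B')
    (g₀ := fun ω => c ^ M * if ω ∈ pivotal A e then cfgWeight x ω else 0)
    (R := fun ω ω' => ∀ j ∉ B, ω' j = ω j) hg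
    (fun ω' => ?_) (fun ω hω => ?_)
  · rw [← Finset.mul_sum] at key
    exact key
  · have := card_eqOn_compl_le ω' B hB
    norm_cast
    convert this
  · by_cases h1 : ω ∈ pivotal A e
    · obtain ⟨f, hf, ω', hω', hj⟩ := h ω h1
      refine ⟨f, hf, ω', hj, ?_⟩
      rw [if_pos h1, if_pos hω']
      exact cfgWeight_mul_pow_le hc hc1 hx hB hj
    · simp [h1] at hω

open Classical in
/-- If the pivotality of every element of `S` can be transferred locally to an element outside `S`,
then a small decrease of the parameters in `S` is compensated by an increase of the others. -/
theorem cfgProb_le_of_transfer {A : Set (α → Bool)} (hA : IsUpperSet A) (S : Finset α)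
    (B : α → Finset α) {M N : ℕ} {c : ℝ} (hc : 0 < c) (hB : ∀ e ∈ S, (B e).card ≤ M)
    (hN : ∀ f, (S.filter fun e => f ∈ B e).card ≤ N)
    (h : ∀ e ∈ S, ∀ ω ∈ pivotal A e,
      ∃ f ∈ B e \ S, ∃ ω' ∈ pivotal A f, ∀ j ∉ B e, ω' j = ω j)
    {p q ε δ : ℝ} (hδ : 0 ≤ δ) (hε : 0 ≤ ε) (hδε : δ * ((2 / c) ^ M * N) ≤ ε)
    (hp : c ≤ p - ε ∧ p + ε ≤ 1 - c) (hq : c ≤ q - δ ∧ q + δ ≤ 1 - c) :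
    cfgProb (fun e => if e ∈ S then q + δ else p - ε) A ≤
      cfgProb (fun e => if e ∈ S then q - δ else p + ε) A := by
  -- The segment of parameters: `t = -1` gives the left-hand side, `t = 1` the right-hand side.
  set x : ℝ → α → ℝ := fun t e => if e ∈ S then q - t * δ else p + t * ε with hxdef
  set x' : α → ℝ := fun e => if e ∈ S then -δ else ε with hx'def
  have hder : ∀ t, HasDerivAt (fun s => cfgProb (x s) A)
      (∑ e, x' e * cfgProb (x t) (pivotal A e)) t := by
    intro t
    refine hasDerivAt_cfgProb hA fun e => ?_
    by_cases he : e ∈ S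
    · simpa [x, x', he] using ((hasDerivAt_id t).mul_const δ).const_sub q
    · simpa [x, x', he] using ((hasDerivAt_id t).mul_const ε).const_add p
  have hnonneg : ∀ t ∈ Set.Icc (-1 : ℝ) 1, 0 ≤ ∑ e, x' e * cfgProb (x t) (pivotal A e) := by
    intro t ht
    have hx : ∀ e, x t e ∈ Set.Icc c (1 - c) := by
      intro e
      by_cases he : e ∈ S
      · simp only [x, he, if_true]
        constructor <;> nlinarith [ht.1, ht.2]
      · simp only [x, he, if_false]
        constructor <;> nlinarith [ht.1, ht.2]
    have hP : ∀ e, 0 ≤ cfgProb (x t) (pivotal A e) := fun e => cfgProb_nonneg hc hx _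
    set P : α → ℝ := fun e => cfgProb (x t) (pivotal A e) with hPdef
    have h1 : ∀ e ∈ S, P e ≤ (2 / c) ^ M * ∑ f ∈ B e \ S, P f := by
      intro e he
      have := cfgProb_pivotal_le hc hx (hB e he) (h e he)
      rw [div_pow, div_mul_eq_mul_div, le_div_iff₀ (by positivity), mul_comm]
      exact this
    -- Double counting: each `f` lies in `B e` for at most `N` elements `e` of `S`.
    have h2 : ∑ e ∈ S, ∑ f ∈ B e \ S, P f ≤ N * ∑ f ∈ Sᶜ, P f := by
      calc ∑ e ∈ S, ∑ f ∈ B e \ S, P f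
          = ∑ e ∈ S, ∑ f ∈ Sᶜ, if f ∈ B e then P f else 0 := by
            refine Finset.sum_congr rfl fun e _ => ?_
            rw [← Finset.sum_filter]
            refine Finset.sum_congr ?_ fun _ _ => rfl
            ext f
            simp [and_comm]
        _ = ∑ f ∈ Sᶜ, ∑ e ∈ S, if f ∈ B e then P f else 0 := Finset.sum_comm
        _ ≤ ∑ f ∈ Sᶜ, N * P f := by
            refine Finset.sum_le_sum fun f _ => ?_
            rw [← Finset.sum_filter, Finset.sum_const, nsmul_eq_mul]
            exact mul_le_mul_of_nonneg_right (by exact_mod_cast hN f) (hP f)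
        _ = _ := (Finset.mul_sum _ _ _).symm
    have h3 : ∑ e ∈ S, P e ≤ (2 / c) ^ M * N * ∑ f ∈ Sᶜ, P f := by
      calc _ ≤ ∑ e ∈ S, (2 / c) ^ M * ∑ f ∈ B e \ S, P f := Finset.sum_le_sum h1
        _ = (2 / c) ^ M * ∑ e ∈ S, ∑ f ∈ B e \ S, P f := (Finset.mul_sum _ _ _).symm
        _ ≤ (2 / c) ^ M * (N * ∑ f ∈ Sᶜ, P f) := mul_le_mul_of_nonneg_left h2 (by positivity)
        _ = _ := by ring
    have h4 : ∑ e, x' e * P e = -δ * ∑ e ∈ S, P e + ε * ∑ f ∈ Sᶜ, P f := by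
      rw [← Finset.sum_add_sum_compl S, Finset.mul_sum, Finset.mul_sum]
      congr 1
      · exact Finset.sum_congr rfl fun e he => by simp [x', he]
      · exact Finset.sum_congr rfl fun e he => by simp [x', Finset.mem_compl.1 he]
    have h5 : 0 ≤ ∑ f ∈ Sᶜ, P f := Finset.sum_nonneg fun f _ => hP f
    rw [h4]
    nlinarith [mul_le_mul_of_nonneg_left h3 hδ, mul_le_mul_of_nonneg_right hδε h5]
  have hmono : MonotoneOn (fun s => cfgProb (x s) A) (Set.Icc (-1 : ℝ) 1) := by
    refine monotoneOn_of_deriv_nonneg (convex_Icc _ _)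
      (fun t _ => (hder t).continuousAt.continuousWithinAt)
      (fun t _ => (hder t).differentiableAt.differentiableWithinAt) fun t ht => ?_
    rw [(hder t).deriv]
    exact hnonneg t (interior_subset ht)
  have := hmono (by norm_num : (-1 : ℝ) ∈ Set.Icc (-1 : ℝ) 1)
    (by norm_num : (1 : ℝ) ∈ Set.Icc (-1 : ℝ) 1) (by norm_num)
  simpa [x, sub_eq_add_neg] using this

end FiniteProduct

/-! ### Escape from a vertex set, and decisive edges. -/

section Escape

variable {X : Type*}

/-- The vertex `x` is joined by edges of `S` to a vertex outside `W`. -/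
def Escapes (W : Set X) (x : X) (S : Set (Sym2 X)) : Prop :=
  ∃ y ∉ W, (SimpleGraph.fromEdgeSet S).Reachable x y

/-- The elements of `S` with both ends in `P`. -/
def within (S : Set (Sym2 X)) (P : Set X) : Set (Sym2 X) := {e | e ∈ S ∧ ∀ z ∈ e, z ∈ P}

lemma mem_within {S : Set (Sym2 X)} {P : Set X} {a b : X} :
    s(a, b) ∈ within S P ↔ s(a, b) ∈ S ∧ a ∈ P ∧ b ∈ P := by
  simp [within]

lemma within_mono {S S' : Set (Sym2 X)} {P P' : Set X} (hS : S ⊆ S') (hP : P ⊆ P') :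
    within S P ⊆ within S' P' :=
  fun _ he => ⟨hS he.1, fun z hz => hP (he.2 z hz)⟩

lemma reachable_mono {S S' : Set (Sym2 X)} (h : S ⊆ S') {x y : X}
    (hr : (SimpleGraph.fromEdgeSet S).Reachable x y) :
    (SimpleGraph.fromEdgeSet S').Reachable x y :=
  hr.mono (SimpleGraph.fromEdgeSet_mono h)

lemma reachable_of_mem {S : Set (Sym2 X)} {x y : X} (h : s(x, y) ∈ S) :
    (SimpleGraph.fromEdgeSet S).Reachable x y := by
  by_cases hxy : x = y
  · subst hxy; rfl
  · exact SimpleGraph.Adj.reachable ((SimpleGraph.fromEdgeSet_adj S).2 ⟨h, hxy⟩)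

/-- The invariant principle behind most connectivity arguments below, applied with `P` a cluster, a
set of escaping vertices, or a variant of these. -/
lemma mem_of_reachable {S : Set (Sym2 X)} {P : Set X}
    (hP : ∀ a b, s(a, b) ∈ S → a ∈ P → b ∈ P) {x y : X} (hx : x ∈ P)
    (h : (SimpleGraph.fromEdgeSet S).Reachable x y) : y ∈ P := by
  obtain ⟨p⟩ := h
  induction p with
  | nil => exact hx
  | cons hadj _ ih => exact ih (hP _ _ ((SimpleGraph.fromEdgeSet_adj S).1 hadj).1 hx)

lemma eq_of_reachable_of_isolated {S : Set (Sym2 X)} {x y : X} (h : ∀ z, s(x, z) ∉ S)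
    (hr : (SimpleGraph.fromEdgeSet S).Reachable x y) : y = x :=
  mem_of_reachable (P := {x}) (fun a b hab ha => by
    rw [Set.mem_singleton_iff] at ha; subst ha; exact absurd hab (h b)) rfl hr

lemma Escapes.mono {W : Set X} {x : X} {S S' : Set (Sym2 X)} (h : S ⊆ S') (hS : Escapes W x S) :
    Escapes W x S' := by
  obtain ⟨y, hy, hr⟩ := hS
  exact ⟨y, hy, reachable_mono h hr⟩

lemma Escapes.of_reachable {W : Set X} {x y : X} {S : Set (Sym2 X)}
    (hr : (SimpleGraph.fromEdgeSet S).Reachable x y) (h : Escapes W y S) : Escapes W x S := by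
  obtain ⟨z, hz, hyz⟩ := h
  exact ⟨z, hz, hr.trans hyz⟩

/-- Whether `x` escapes from `W` depends only on the edges which touch `W`. -/
lemma Escapes.of_touching {W : Set X} {x : X} {S S' : Set (Sym2 X)}
    (h : ∀ e ∈ S, (∃ z ∈ e, z ∈ W) → e ∈ S') (hS : Escapes W x S) : Escapes W x S' := by
  obtain ⟨y, hy, ⟨p⟩⟩ := hS
  induction p with
  | nil => exact ⟨_, hy, SimpleGraph.Reachable.refl _⟩
  | @cons u v w hadj _ ih =>
    by_cases hu : u ∈ W
    · have he := h _ ((SimpleGraph.fromEdgeSet_adj S).1 hadj).1 ⟨u, Sym2.mem_mk_left u v, hu⟩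
      exact (ih hy).of_reachable (reachable_of_mem he)
    · exact ⟨u, hu, SimpleGraph.Reachable.refl _⟩

/-- If `Q` missed the `S`-cluster of `x`, adding `T` would not enlarge that cluster. If no vertex of
`Q` escaped, the set of vertices escaping through `S` would be closed under `S ∪ T`, hence contain
`x`. -/
lemma exists_mem_of_not_escapes {W : Set X} {x : X} {S T : Set (Sym2 X)} {Q : Set X}
    (hT : ∀ e ∈ T, ∀ z ∈ e, z ∈ Q) (h₀ : ¬ Escapes W x S) (h₁ : Escapes W x (S ∪ T)) :
    (∃ a ∈ Q, (SimpleGraph.fromEdgeSet S).Reachable x a) ∧ ∃ b ∈ Q, Escapes W b S := by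
  obtain ⟨y, hy, hr⟩ := h₁
  constructor
  · by_contra! hcon
    refine h₀ ⟨y, hy, ?_⟩
    refine mem_of_reachable (P := {z | (SimpleGraph.fromEdgeSet S).Reachable x z}) ?_
      (SimpleGraph.Reachable.refl x) hr
    rintro a b (hab | hab) ha
    · exact SimpleGraph.Reachable.trans ha (reachable_of_mem hab)
    · exact absurd ha (hcon a (hT _ hab a (Sym2.mem_mk_left a b)))
  · by_contra! hcon
    refine h₀ ?_
    refine mem_of_reachable (P := {z | Escapes W z S}) ?_
      (⟨y, hy, SimpleGraph.Reachable.refl y⟩ : Escapes W y S) hr.symm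
    rintro a b (hab | hab) ha
    · exact Escapes.of_reachable (reachable_of_mem (Sym2.eq_swap ▸ hab)) ha
    · exact absurd ha (hcon a (hT _ hab a (Sym2.mem_mk_left a b)))

/-- Two disjoint vertex sets, one attached to the cluster of `x` and the other to the outside of
`W`, are not joined by inner edges, but they are joined by outer edges. -/
lemma escapes_of_separated {W : Set X} {x : X} {S Bi Bo : Set (Sym2 X)} {P P' : Set X}
    {a b c d : X} (h₀ : ¬ Escapes W x S) (ha : (SimpleGraph.fromEdgeSet S).Reachable x a)
    (hb : Escapes W b S) (hdisj : Disjoint P P')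
    (hP : ∀ z ∈ P, z ≠ a → z ∈ W ∧ z ≠ x ∧ ∀ y, s(z, y) ∉ S)
    (hP' : ∀ z ∈ P', z ≠ b → z ∈ W ∧ z ≠ x ∧ ∀ y, s(z, y) ∉ S)
    (haP : a ∈ P)
    (hac : (SimpleGraph.fromEdgeSet (within Bi P)).Reachable a c)
    (hbd : (SimpleGraph.fromEdgeSet (within Bi P')).Reachable b d)
    (hcd : (SimpleGraph.fromEdgeSet Bo).Reachable c d) :
    ¬ Escapes W x (S ∪ (within Bi P ∪ within Bi P')) ∧
      Escapes W x (S ∪ (within Bi P ∪ within Bi P') ∪ Bo) := by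
  constructor
  · rintro ⟨y, hy, hr⟩
    -- This set is closed under the edges present: `S` can leave `P` only at `a`, and an edge within
    -- `P'` could meet the cluster only at `b`, in which case `x` would already escape.
    have hmem : y ∈ {z | (SimpleGraph.fromEdgeSet S).Reachable x z} ∪ P := by
      refine mem_of_reachable ?_ (Or.inl (SimpleGraph.Reachable.refl x)) hr
      rintro u v (huv | huv | huv) hu
      · left
        rcases hu with hu | hu
        · exact SimpleGraph.Reachable.trans hu (reachable_of_mem huv)
        · by_cases hua : u = a
          · subst hua
            exact ha.trans (reachable_of_mem huv)
          · exact absurd huv ((hP u hu hua).2.2 v)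
      · exact Or.inr (mem_within.1 huv).2.2
      · exfalso
        have huP' := (mem_within.1 huv).2.1
        rcases hu with hu | hu
        · by_cases hub : u = b
          · subst hub
            exact h₀ (hb.of_reachable hu)
          · obtain ⟨-, hux, hiso⟩ := hP' u huP' hub
            exact hux (eq_of_reachable_of_isolated hiso (SimpleGraph.Reachable.symm hu)).symm
        · exact Set.disjoint_left.1 hdisj hu huP'
    rcases hmem with hmem | hmem
    · exact h₀ ⟨y, hy, hmem⟩
    · by_cases hya : y = a
      · subst hya
        exact h₀ ⟨y, hy, ha⟩
      · exact hy (hP y hmem hya).1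
  · have h1 := reachable_mono (S' := S ∪ (within Bi P ∪ within Bi P') ∪ Bo)
      (by intro e he; exact Or.inl (Or.inl he)) ha
    have h2 := reachable_mono (S' := S ∪ (within Bi P ∪ within Bi P') ∪ Bo)
      (by intro e he; exact Or.inl (Or.inr (Or.inl he))) hac
    have h3 := reachable_mono (S' := S ∪ (within Bi P ∪ within Bi P') ∪ Bo)
      (by intro e he; exact Or.inl (Or.inr (Or.inr he))) hbd
    have h4 := reachable_mono (S' := S ∪ (within Bi P ∪ within Bi P') ∪ Bo)
      (by intro e he; exact Or.inr he) hcd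
    have h5 := hb.mono (S' := S ∪ (within Bi P ∪ within Bi P') ∪ Bo)
      (by intro e he; exact Or.inl (Or.inl he))
    exact h5.of_reachable (h1.trans (h2.trans (h4.trans h3.symm)))

/-- If adding a finite set of edges creates an escape, then one of them does so at some stage. -/
lemma exists_decisive_edge {W : Set X} {x : X} {S B : Set (Sym2 X)} (hB : B.Finite)
    (h₀ : ¬ Escapes W x S) (h₁ : Escapes W x (S ∪ B)) :
    ∃ f ∈ B, ∃ C ⊆ B, Escapes W x (S ∪ C ∪ {f}) ∧ ¬ Escapes W x ((S ∪ C) \ {f}) := by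
  induction B, hB using Set.Finite.induction_on with
  | empty => simp [h₀] at h₁
  | @insert f B _ _ ih =>
    by_cases h : Escapes W x (S ∪ B)
    · obtain ⟨g, hg, C, hC, hh⟩ := ih h
      exact ⟨g, Or.inr hg, C, hC.trans (Set.subset_insert _ _), hh⟩
    · refine ⟨f, Or.inl rfl, B, Set.subset_insert _ _, ?_, fun h' => h (h'.mono Set.sdiff_subset)⟩
      convert h₁ using 1
      ext e
      simp only [Set.mem_union, Set.mem_singleton_iff, Set.mem_insert_iff]
      tauto

end Escape

/-! ### Disjoint connections inside two levels above a connected subgraph. -/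

section Connections

/-- In a connected subgraph, one of two vertices can be joined to a third one
without passing through the other. -/
lemma reachable_avoiding {V : Type*} {G : SimpleGraph V} {H : G.Subgraph} (hH : H.Connected)
    {u u' u₀ : V} (hu : u ∈ H.verts) (hu₀ : u₀ ∈ H.verts) (hne : u ≠ u') :
    (SimpleGraph.fromEdgeSet (within H.edgeSet {z | z ≠ u'})).Reachable u u₀ ∨
      (SimpleGraph.fromEdgeSet (within H.edgeSet {z | z ≠ u})).Reachable u' u₀ := by
  by_contra! hcon
  obtain ⟨h1, h2⟩ := hcon
  have hne1 : u₀ ≠ u := by rintro rfl; exact h1 (SimpleGraph.Reachable.refl _)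
  have hne2 : u₀ ≠ u' := by rintro rfl; exact h2 (SimpleGraph.Reachable.refl _)
  -- Delete both vertices. A walk from `u₀` to `u` must leave the component of `u₀`, and its exit
  -- vertex is `u` or `u'`, which is thus joined to `u₀` avoiding the other.
  set E := within H.edgeSet {z | z ≠ u ∧ z ≠ u'} with hE
  have hiso : ∀ z, s(u, z) ∉ E := fun z hz => (mem_within.1 hz).2.1.1 rfl
  have hiso' : ∀ z, s(u', z) ∉ E := fun z hz => (mem_within.1 hz).2.1.2 rfl
  have hreach : (SimpleGraph.fromEdgeSet H.edgeSet).Reachable u₀ u := by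
    have h3 := hH.coe.preconnected ⟨u₀, hu₀⟩ ⟨u, hu⟩
    refine h3.map (⟨fun z => z.1, ?_⟩ : H.coe →g SimpleGraph.fromEdgeSet H.edgeSet)
    intro a b hab
    rw [SimpleGraph.fromEdgeSet_adj]
    exact ⟨hab, fun h => hab.ne (Subtype.ext h)⟩
  have hmem : (SimpleGraph.fromEdgeSet E).Reachable u₀ u := by
    refine mem_of_reachable (P := {z | (SimpleGraph.fromEdgeSet E).Reachable u₀ z}) ?_
      (SimpleGraph.Reachable.refl _) hreach
    intro y z hyz hy
    have hyu : y ≠ u := by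
      rintro rfl
      exact hne1 (eq_of_reachable_of_isolated hiso (SimpleGraph.Reachable.symm hy))
    have hyu' : y ≠ u' := by
      rintro rfl
      exact hne2 (eq_of_reachable_of_isolated hiso' (SimpleGraph.Reachable.symm hy))
    by_cases hzu : z = u
    · subst hzu
      refine absurd ?_ h1
      have h4 : s(y, z) ∈ within H.edgeSet {z | z ≠ u'} := mem_within.2 ⟨hyz, hyu', hne⟩
      exact ((reachable_mono (within_mono le_rfl fun z hz => hz.2) hy).trans
        (reachable_of_mem h4)).symm
    · by_cases hzu' : z = u'
      · subst hzu'
        refine absurd ?_ h2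
        have h4 : s(y, z) ∈ within H.edgeSet {z | z ≠ u} := mem_within.2 ⟨hyz, hyu, hne.symm⟩
        exact ((reachable_mono (within_mono le_rfl fun z hz => hz.1) hy).trans
          (reachable_of_mem h4)).symm
      · exact SimpleGraph.Reachable.trans hy
          (reachable_of_mem (mem_within.2 ⟨hyz, ⟨hyu, hyu'⟩, hzu, hzu'⟩))
  exact hne1 (eq_of_reachable_of_isolated hiso hmem.symm)

variable {V : Type*} {G : SimpleGraph V}

lemma reachable_level {H : G.Subgraph} {Bi : Set (Sym2 (V × ℤ))} {P : Set (V × ℤ)} {Q : Set V}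
    {l : ℤ} (hBi : ∀ u v, H.Adj u v → s((u, l), (v, l)) ∈ Bi)
    (hP : ∀ u ∈ H.verts, u ∈ Q → (u, l) ∈ P) {u v : V}
    (h : (SimpleGraph.fromEdgeSet (within H.edgeSet Q)).Reachable u v) :
    (SimpleGraph.fromEdgeSet (within Bi P)).Reachable (u, l) (v, l) := by
  refine mem_of_reachable
    (P := {z | (SimpleGraph.fromEdgeSet (within Bi P)).Reachable (u, l) (z, l)}) ?_
    (SimpleGraph.Reachable.refl _) h
  intro a b hab ha
  obtain ⟨hadj, haQ, hbQ⟩ := mem_within.1 hab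
  rw [SimpleGraph.Subgraph.mem_edgeSet] at hadj
  exact SimpleGraph.Reachable.trans ha (reachable_of_mem (mem_within.2
    ⟨hBi a b hadj, hP a hadj.fst_mem haQ, hP b hadj.snd_mem hbQ⟩))

/-- The vertices `a` and `b` can be joined by `Bi` to the two vertices above `u₀` on the levels `m`
and `m + 1` within disjoint sets, consisting of vertices of these two levels above `H` and of `a`
and `b`, respectively. -/
def Separable (H : G.Subgraph) (Bi : Set (Sym2 (V × ℤ))) (m : ℤ) (u₀ : V) (a b : V × ℤ) : Prop :=
  ∃ (P P' : Set (V × ℤ)) (l l' : ℤ), Disjoint P P' ∧ a ∈ P ∧ b ∈ P' ∧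
    (∀ z ∈ P, z ≠ a → z.1 ∈ H.verts ∧ (z.2 = m ∨ z.2 = m + 1)) ∧
    (∀ z ∈ P', z ≠ b → z.1 ∈ H.verts ∧ (z.2 = m ∨ z.2 = m + 1)) ∧
    (l = m ∧ l' = m + 1 ∨ l = m + 1 ∧ l' = m) ∧
    (SimpleGraph.fromEdgeSet (within Bi P)).Reachable a (u₀, l) ∧
    (SimpleGraph.fromEdgeSet (within Bi P')).Reachable b (u₀, l')

lemma Separable.symm {H : G.Subgraph} {Bi : Set (Sym2 (V × ℤ))} {m : ℤ} {u₀ : V} {a b : V × ℤ}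
    (h : Separable H Bi m u₀ a b) : Separable H Bi m u₀ b a := by
  obtain ⟨P, P', l, l', h1, h2, h3, h4, h5, h6, h7, h8⟩ := h
  exact ⟨P', P, l', l, h1.symm, h3, h2, h5, h4, by tauto, h8, h7⟩

/-- If `a` and `b` lie on opposite sides of the two levels, each steps to its nearest level and
travels there to `u₀`. If they lie on the same side, one can travel on the near level avoiding the
column of the other, while the other crosses straight to the far level. -/
lemma separable_of_ne {H : G.Subgraph} (hH : H.Connected) {Bi : Set (Sym2 (V × ℤ))} {m : ℤ}
    (hhor : ∀ u v l, H.Adj u v → (l = m ∨ l = m + 1) → s((u, l), (v, l)) ∈ Bi)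
    (hver : ∀ u l l', u ∈ H.verts → (l = m ∨ l = m + 1) → (l' = l + 1 ∨ l = l' + 1) →
      s((u, l), (u, l')) ∈ Bi)
    {u₀ : V} (hu₀ : u₀ ∈ H.verts) {a b : V × ℤ} (ha : a.1 ∈ H.verts) (hb : b.1 ∈ H.verts)
    (ha' : a.2 = m - 1 ∨ a.2 = m + 2) (hb' : b.2 = m - 1 ∨ b.2 = m + 2) (hab : a ≠ b) :
    Separable H Bi m u₀ a b := by
  obtain ⟨u, s⟩ := a
  obtain ⟨u', s'⟩ := b
  dsimp only at ha hb ha' hb'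
  have hver' : ∀ u l l', u ∈ H.verts → (l = m ∨ l = m + 1) → (l' = l + 1 ∨ l = l' + 1) →
      s((u, l'), (u, l)) ∈ Bi := fun u l l' h1 h2 h3 => Sym2.eq_swap ▸ hver u l l' h1 h2 h3
  have hall : ∀ u ∈ H.verts,
      (SimpleGraph.fromEdgeSet (within H.edgeSet Set.univ)).Reachable u u₀ := by
    intro u hu
    refine (hH.coe.preconnected ⟨u, hu⟩ ⟨u₀, hu₀⟩).map
      (⟨fun z => z.1, ?_⟩ : H.coe →g SimpleGraph.fromEdgeSet (within H.edgeSet Set.univ))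
    intro a b hab
    rw [SimpleGraph.fromEdgeSet_adj]
    exact ⟨mem_within.2 ⟨hab, trivial, trivial⟩, fun h => hab.ne (Subtype.ext h)⟩
  -- the two interior levels, the first one being the closest to `s`
  obtain ⟨l, l', hl, hs⟩ : ∃ l l', (l = m ∧ l' = m + 1 ∨ l = m + 1 ∧ l' = m) ∧ s = 2 * l - l' := by
    rcases ha' with h | h
    · exact ⟨m, m + 1, Or.inl ⟨rfl, rfl⟩, by omega⟩
    · exact ⟨m + 1, m, Or.inr ⟨rfl, rfl⟩, by omega⟩
  have hlm : l = m ∨ l = m + 1 := by omega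
  have hlm' : l' = m ∨ l' = m + 1 := by omega
  by_cases hss : s = s'
  · subst hss
    have hne : u ≠ u' := by rintro rfl; exact hab rfl
    -- Stated for either order, since `reachable_avoiding` does not say which column can be avoided.
    have aux : ∀ u u', u ∈ H.verts → u' ∈ H.verts → u ≠ u' →
        (SimpleGraph.fromEdgeSet (within H.edgeSet {z | z ≠ u'})).Reachable u u₀ →
        Separable H Bi m u₀ (u, s) (u', s) := by
      intro u u' hu hu' hne hr
      refine ⟨insert (u, s) {z | z.1 ∈ H.verts ∧ z.1 ≠ u' ∧ z.2 = l},
        insert (u', s) (insert (u', l) {z | z.1 ∈ H.verts ∧ z.2 = l'}), l, l', ?_,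
        Set.mem_insert _ _, Set.mem_insert _ _, ?_, ?_, hl, ?_, ?_⟩
      · rw [Set.disjoint_left]
        rintro ⟨t, k⟩ (h | ⟨-, h1, h2⟩) (h' | h' | ⟨-, h3⟩) <;>
          simp only [Prod.mk.injEq] at * <;> first | omega | (exact h1 h'.1) | (exact hne (h.1.symm.trans h'.1))
      · rintro ⟨t, k⟩ (h | ⟨h1, -, h2⟩) hz
        · exact absurd h hz
        · exact ⟨h1, h2 ▸ hlm⟩
      · rintro ⟨t, k⟩ (h | h | ⟨h1, h2⟩) hz
        · exact absurd h hz
        · obtain ⟨rfl, rfl⟩ : t = u' ∧ k = l := by simpa using h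
          exact ⟨hu', hlm⟩
        · exact ⟨h1, h2 ▸ hlm'⟩
      · refine SimpleGraph.Reachable.trans (reachable_of_mem (mem_within.2 ⟨hver' u l s hu hlm (by omega), Set.mem_insert _ _,
          Or.inr ⟨hu, hne, rfl⟩⟩)) ?_
        exact reachable_level (fun a b h => hhor a b l h hlm) (fun z h1 h2 => Or.inr ⟨h1, h2, rfl⟩) hr
      · refine SimpleGraph.Reachable.trans (reachable_of_mem (mem_within.2 ⟨hver' u' l s hu' hlm (by omega),
          Set.mem_insert _ _, Or.inr (Or.inl rfl)⟩)) ?_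
        refine SimpleGraph.Reachable.trans (reachable_of_mem (mem_within.2 ⟨hver u' l l' hu' hlm (by omega),
          Or.inr (Or.inl rfl), Or.inr (Or.inr ⟨hu', rfl⟩)⟩)) ?_
        exact reachable_level (fun a b h => hhor a b l' h hlm')
          (fun z h1 _ => Or.inr (Or.inr ⟨h1, rfl⟩)) (hall u' hu')
    rcases reachable_avoiding hH ha hu₀ hne with h | h
    · exact aux u u' ha hb hne h
    · exact (aux u' u hb ha hne.symm h).symm
  · have hs' : s' = 2 * l' - l := by omega
    refine ⟨insert (u, s) {z | z.1 ∈ H.verts ∧ z.2 = l},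
      insert (u', s') {z | z.1 ∈ H.verts ∧ z.2 = l'}, l, l', ?_,
      Set.mem_insert _ _, Set.mem_insert _ _, ?_, ?_, hl, ?_, ?_⟩
    · rw [Set.disjoint_left]
      rintro ⟨t, k⟩ (h | ⟨-, h2⟩) (h' | ⟨-, h3⟩) <;>
        simp only [Prod.mk.injEq] at * <;> omega
    · rintro ⟨t, k⟩ (h | ⟨h1, h2⟩) hz
      · exact absurd h hz
      · exact ⟨h1, h2 ▸ hlm⟩
    · rintro ⟨t, k⟩ (h | ⟨h1, h2⟩) hz
      · exact absurd h hz
      · exact ⟨h1, h2 ▸ hlm'⟩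
    · refine SimpleGraph.Reachable.trans (reachable_of_mem (mem_within.2 ⟨hver' u l s ha hlm (by omega), Set.mem_insert _ _,
        Or.inr ⟨ha, rfl⟩⟩)) ?_
      exact reachable_level (fun a b h => hhor a b l h hlm) (fun z h1 _ => Or.inr ⟨h1, rfl⟩)
        (hall u ha)
    · refine SimpleGraph.Reachable.trans (reachable_of_mem (mem_within.2 ⟨hver' u' l' s' hb hlm' (by omega),
        Set.mem_insert _ _, Or.inr ⟨hb, rfl⟩⟩)) ?_
      exact reachable_level (fun a b h => hhor a b l' h hlm') (fun z h1 _ => Or.inr ⟨h1, rfl⟩)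
        (hall u' hb)

end Connections

/-! ### Boxes, and the surgery that makes an outer edge decisive. -/

section Box

variable {V : Type*} {G : SimpleGraph V}

lemma ladder_adj {u v : V} {l l' : ℤ} : (ladder G).Adj (u, l) (v, l') ↔
    (G.Adj u v ∧ l = l') ∨ (u = v ∧ (l' = l + 1 ∨ l = l' + 1)) := by
  simp only [ladder, SimpleGraph.boxProd_adj, SimpleGraph.hasse_adj, Order.covBy_iff_add_one_eq]
  constructor
  · rintro (h | ⟨h, h'⟩)
    · exact Or.inl h
    · exact Or.inr ⟨h', by omega⟩
  · rintro (h | ⟨h', h⟩)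
    · exact Or.inl h
    · exact Or.inr ⟨by omega, h'⟩

/-- The edges of the ladder with an end in `Y`. -/
def touching (G : SimpleGraph V) (Y : Set (V × ℤ)) : Set (Sym2 (V × ℤ)) :=
  {e | e ∈ (ladder G).edgeSet ∧ ∃ z ∈ e, z ∈ Y}

lemma mem_touching {Y : Set (V × ℤ)} {a b : V × ℤ} :
    s(a, b) ∈ touching G Y ↔ (ladder G).Adj a b ∧ (a ∈ Y ∨ b ∈ Y) := by
  refine and_congr_right fun _ => ⟨?_, ?_⟩
  · rintro ⟨z, hz, hzY⟩
    rcases Sym2.mem_iff.1 hz with rfl | rfl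
    exacts [Or.inl hzY, Or.inr hzY]
  · rintro (h | h)
    exacts [⟨a, Sym2.mem_mk_left a b, h⟩, ⟨b, Sym2.mem_mk_right a b, h⟩]

/-- The vertices on the levels `m` and `m + 1` above `H` and above its neighbours. -/
def boxVerts (H : G.Subgraph) (m : ℤ) : Set (V × ℤ) :=
  {z | (z.2 = m ∨ z.2 = m + 1) ∧ (z.1 ∈ H.verts ∨ ∃ u ∈ H.verts, G.Adj u z.1)}

/-- The edges with an end in `boxVerts H m`. -/
def box (H : G.Subgraph) (m : ℤ) : Set (Sym2 (V × ℤ)) := touching G (boxVerts H m)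

lemma eq_of_walk_length_le_two {H : ℕ → G.Subgraph}
    (hH : ∀ i j, i ≠ j → 3 ≤ setDist G (H i).verts (H j).verts) {i j : ℕ} {u v : V}
    (hu : u ∈ (H i).verts) (hv : v ∈ (H j).verts) (p : G.Walk u v) (hp : p.length ≤ 2) :
    i = j := by
  by_contra hij
  have h1 : setDist G (H i).verts (H j).verts ≤ G.edist u v :=
    (iInf₂_le u hu).trans (iInf₂_le v hv)
  have h2 := ((hH i j hij).trans h1).trans p.edist_le
  have h3 : 3 ≤ p.length := by exact_mod_cast h2
  omega

/-- A column within distance 1 of both subgraphs would put them within distance 2. The levels are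
irrelevant. -/
lemma eq_of_mem_boxVerts {H : ℕ → G.Subgraph}
    (hH : ∀ i j, i ≠ j → 3 ≤ setDist G (H i).verts (H j).verts) {i j : ℕ} {m m' : ℤ}
    {z z' : V × ℤ} (hzz : z.1 = z'.1) (hz : z ∈ boxVerts (H i) m) (hz' : z' ∈ boxVerts (H j) m') :
    i = j := by
  obtain ⟨t, l⟩ := z
  obtain ⟨t', l'⟩ := z'
  dsimp only at hzz
  subst hzz
  rcases hz.2 with h | ⟨u, hu, h⟩ <;> rcases hz'.2 with h' | ⟨u', hu', h'⟩
  · exact eq_of_walk_length_le_two hH h h' .nil (by simp)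
  · exact eq_of_walk_length_le_two hH h hu' (.cons h'.symm .nil) (by simp)
  · exact eq_of_walk_length_le_two hH hu h' (.cons h .nil) (by simp)
  · exact eq_of_walk_length_le_two hH hu hu' (.cons h (.cons h'.symm .nil)) (by simp)

/-- The box sees no subgraph other than `H r`; hence a box edge with an end above a vertex outside
`H r` is outer. -/
lemma mem_of_mem_box_of_inner {H : ℕ → G.Subgraph}
    (hH : ∀ i j, i ≠ j → 3 ≤ setDist G (H i).verts (H j).verts) {r : ℕ} {m : ℤ}
    {e : Sym2 (V × ℤ)} (he : e ∈ box (H r) m) (he' : e ∈ ⋃ r, inEdges (H r)) :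
    ∀ z ∈ e, z.1 ∈ (H r).verts ∧ m - 1 ≤ z.2 ∧ z.2 ≤ m + 2 := by
  obtain ⟨s, hs⟩ := Set.mem_iUnion.1 he'
  have key : ∀ z ∈ boxVerts (H r) m, z.1 ∈ (H s).verts → s = r := fun z hz hzs =>
    eq_of_mem_boxVerts hH (z := z) (m := z.2) rfl ⟨Or.inl rfl, Or.inl hzs⟩ hz
  rcases hs with ⟨u, v, n, huv, rfl⟩ | ⟨w, n, hw, rfl⟩
  · obtain ⟨-, h⟩ := mem_touching.1 he
    have hsr : s = r := by
      rcases h with h | h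
      exacts [key _ h huv.fst_mem, key _ h huv.snd_mem]
    subst hsr
    have hn : n = m ∨ n = m + 1 := by
      rcases h with h | h
      exacts [h.1, h.1]
    intro z hz
    rcases Sym2.mem_iff.1 hz with rfl | rfl
    · exact ⟨huv.fst_mem, by dsimp only; omega, by dsimp only; omega⟩
    · exact ⟨huv.snd_mem, by dsimp only; omega, by dsimp only; omega⟩
  · obtain ⟨-, h⟩ := mem_touching.1 he
    have hsr : s = r := by
      rcases h with h | h
      exacts [key _ h hw, key _ h hw]
    subst hsr
    have hn : (n = m ∨ n = m + 1) ∨ (n + 1 = m ∨ n + 1 = m + 1) := by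
      rcases h with h | h
      exacts [Or.inl h.1, Or.inr h.1]
    intro z hz
    rcases Sym2.mem_iff.1 hz with rfl | rfl
    · exact ⟨hw, by dsimp only; omega, by dsimp only; omega⟩
    · exact ⟨hw, by dsimp only; omega, by dsimp only; omega⟩

lemma exists_adj_notMem [Infinite V] (hconn : G.Connected) {U : Set V} (hU : U.Finite)
    (hne : U.Nonempty) : ∃ u ∈ U, ∃ w ∉ U, G.Adj u w := by
  obtain ⟨u, hu⟩ := hne
  obtain ⟨w, hw⟩ := hU.exists_notMem
  obtain ⟨p⟩ := hconn.preconnected u w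
  obtain ⟨d, -, h1, h2⟩ := p.exists_boundary_dart U hu hw
  exact ⟨d.fst, h1, d.snd, h2, d.adj⟩

/-- If an edge of a box decides whether `x` escapes from `W`, then after a change of the states
of the edges of the box an outer edge of the box does so. -/
theorem exists_outer_decisive_edge [Infinite V] (hconn : G.Connected) {H : ℕ → G.Subgraph}
    (hHfin : ∀ r, (H r).verts.Finite) (hHconn : ∀ r, (H r).Connected)
    (hH : ∀ i j, i ≠ j → 3 ≤ setDist G (H i).verts (H j).verts)
    {W : Set (V × ℤ)} {x : V × ℤ} {r : ℕ} {m : ℤ}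
    (hW : ∀ u ∈ (H r).verts, (u, m) ∈ W ∧ (u, m + 1) ∈ W) (hx : x.1 ∉ (H r).verts)
    (hfin : (box (H r) m).Finite) {S : Set (Sym2 (V × ℤ))} (hS : S ⊆ (ladder G).edgeSet)
    {e : Sym2 (V × ℤ)} (he : e ∈ box (H r) m) (h₁ : Escapes W x (S ∪ {e}))
    (h₀ : ¬ Escapes W x (S \ {e})) :
    ∃ f ∈ box (H r) m, f ∉ ⋃ r, inEdges (H r) ∧ ∃ S' : Set (Sym2 (V × ℤ)),
      (∀ g ∉ box (H r) m, g ∈ S' ↔ g ∈ S) ∧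
      Escapes W x (S' ∪ {f}) ∧ ¬ Escapes W x (S' \ {f}) := by
  set B := box (H r) m with hB
  set Bi := B ∩ ⋃ r, inEdges (H r) with hBi
  set Bo := B \ ⋃ r, inEdges (H r) with hBo
  set S₀ := S \ B with hS₀
  have h₀' : ¬ Escapes W x S₀ := fun h => h₀ (h.mono fun g hg =>
    ⟨hg.1, fun hge => hg.2 (by rw [Set.mem_singleton_iff.1 hge]; exact he)⟩)
  have h₁' : Escapes W x (S₀ ∪ B) := by
    refine h₁.mono ?_
    rintro g (hg | hg)
    · by_cases hgB : g ∈ B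
      exacts [Or.inr hgB, Or.inl ⟨hg, hgB⟩]
    · rw [Set.mem_singleton_iff.1 hg]
      exact Or.inr he
  -- It suffices to find a state of the box from which opening outer edges alone creates the escape.
  -- All inner edges serve as `J` unless they already cause it.
  obtain ⟨J, hJ, hJ₀, hJ₁⟩ : ∃ J ⊆ B, ¬ Escapes W x (S₀ ∪ J) ∧ Escapes W x (S₀ ∪ J ∪ Bo) := by
    by_cases hI : Escapes W x (S₀ ∪ Bi)
    swap
    · refine ⟨Bi, Set.inter_subset_left, hI, ?_⟩
      rwa [Set.union_assoc, Set.inter_union_sdiff]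
    have hiso : ∀ z : V × ℤ, z.1 ∈ (H r).verts → (z.2 = m ∨ z.2 = m + 1) →
        ∀ y, s(z, y) ∉ S₀ := by
      intro z hz hz' y hy
      exact hy.2 ⟨hS hy.1, z, Sym2.mem_mk_left z y, hz', Or.inl hz⟩
    have hzW : ∀ z : V × ℤ, z.1 ∈ (H r).verts → (z.2 = m ∨ z.2 = m + 1) → z ∈ W := by
      rintro ⟨z, l⟩ hz (h | h)
      · dsimp only at hz h; subst h; exact (hW z hz).1
      · dsimp only at hz h; subst h; exact (hW z hz).2
    have hzx : ∀ z : V × ℤ, z.1 ∈ (H r).verts → z ≠ x := by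
      rintro z hz rfl
      exact hx hz
    obtain ⟨⟨a, ⟨haU, ha1, ha2⟩, ha⟩, b, ⟨hbU, hb1, hb2⟩, hb⟩ := exists_mem_of_not_escapes
      (Q := {z | z.1 ∈ (H r).verts ∧ m - 1 ≤ z.2 ∧ z.2 ≤ m + 2})
      (fun g hg => mem_of_mem_box_of_inner hH hg.1 hg.2) h₀' hI
    -- Vertices above `H r` on the two levels are isolated in `S₀`, lie in `W` and differ from `x`,
    -- so `a` and `b` sit on the levels `m - 1` or `m + 2`.
    have ha' : ¬ (a.2 = m ∨ a.2 = m + 1) := fun h =>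
      hzx a haU (eq_of_reachable_of_isolated (hiso a haU h) ha.symm).symm
    have hb' : ¬ (b.2 = m ∨ b.2 = m + 1) := by
      intro h
      obtain ⟨y, hy, hby⟩ := hb
      rw [eq_of_reachable_of_isolated (hiso b hbU h) hby] at hy
      exact hy (hzW b hbU h)
    have hab : a ≠ b := by
      rintro rfl
      exact h₀' (hb.of_reachable ha)
    -- The column of `w` carries the outer detour between the two levels above `u₀`.
    obtain ⟨u₀, hu₀, w, hw, hadj⟩ := exists_adj_notMem hconn (hHfin r)
      ((hHconn r).nonempty)
    have hbv : ∀ t l, t ∈ (H r).verts → (l = m ∨ l = m + 1) → (t, l) ∈ boxVerts (H r) m :=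
      fun t l ht hl => ⟨hl, Or.inl ht⟩
    have hsep : Separable (H r) Bi m u₀ a b := by
      refine separable_of_ne (hHconn r) ?_ ?_ hu₀ haU hbU (by omega) (by omega) hab
      · intro u v l huv hl
        refine ⟨mem_touching.2 ⟨ladder_adj.2 (Or.inl ⟨huv.adj_sub, rfl⟩),
          Or.inl (hbv _ _ huv.fst_mem hl)⟩, ?_⟩
        exact Set.mem_iUnion.2 ⟨r, Or.inl ⟨u, v, l, huv, rfl⟩⟩
      · intro u l l' hu hl hll
        refine ⟨mem_touching.2 ⟨ladder_adj.2 (Or.inr ⟨rfl, hll⟩), Or.inl (hbv _ _ hu hl)⟩, ?_⟩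
        refine Set.mem_iUnion.2 ⟨r, Or.inr ?_⟩
        rcases hll with rfl | rfl
        · exact ⟨u, l, hu, rfl⟩
        · exact ⟨u, l', hu, Sym2.eq_swap⟩
    obtain ⟨P, P', l, l', hdisj, haP, -, hP, hP', hll, hac, hbd⟩ := hsep
    have hout : ∀ (g : Sym2 (V × ℤ)) (k : ℤ), g ∈ B → (w, k) ∈ g → g ∈ Bo := fun g k hg hwg =>
      ⟨hg, fun hg' => hw (mem_of_mem_box_of_inner hH hg hg' _ hwg).1⟩
    have hwbox : ∀ k, (k = m ∨ k = m + 1) → (w, k) ∈ boxVerts (H r) m := fun k hk =>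
      ⟨hk, Or.inr ⟨u₀, hu₀, hadj⟩⟩
    have hside : ∀ k, (k = m ∨ k = m + 1) → s((u₀, k), (w, k)) ∈ Bo := fun k hk =>
      hout _ k (mem_touching.2 ⟨ladder_adj.2 (Or.inl ⟨hadj, rfl⟩), Or.inr (hwbox k hk)⟩)
        (Sym2.mem_mk_right _ _)
    have hup : s((w, l), (w, l')) ∈ Bo :=
      hout _ l (mem_touching.2 ⟨ladder_adj.2 (Or.inr ⟨rfl, by omega⟩),
        Or.inl (hwbox l (by omega))⟩) (Sym2.mem_mk_left _ _)
    have hcd : (SimpleGraph.fromEdgeSet Bo).Reachable (u₀, l) (u₀, l') :=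
      (reachable_of_mem (hside l (by omega))).trans ((reachable_of_mem hup).trans
        (reachable_of_mem (hside l' (by omega))).symm)
    obtain ⟨hn, hy⟩ := escapes_of_separated h₀' ha hb hdisj
      (fun z hz hza => ⟨hzW z (hP z hz hza).1 (hP z hz hza).2, hzx z (hP z hz hza).1,
        hiso z (hP z hz hza).1 (hP z hz hza).2⟩)
      (fun z hz hzb => ⟨hzW z (hP' z hz hzb).1 (hP' z hz hzb).2, hzx z (hP' z hz hzb).1,
        hiso z (hP' z hz hzb).1 (hP' z hz hzb).2⟩) haP hac hbd hcd
    refine ⟨_, ?_, hn, hy⟩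
    rintro g (hg | hg)
    exacts [hg.1.1, hg.1.1]
  obtain ⟨f, hf, C, hC, hf₁, hf₀⟩ := exists_decisive_edge (hfin.subset Set.sdiff_subset) hJ₀ hJ₁
  refine ⟨f, hf.1, hf.2, S₀ ∪ J ∪ C, fun g hg => ?_, hf₁, hf₀⟩
  constructor
  · rintro ((h | h) | h)
    exacts [h.1, absurd (hJ h) hg, absurd (hC h).1 hg]
  · exact fun h => Or.inl (Or.inl ⟨h, hg⟩)

end Box

/-! ### Bounds on the size and overlap of boxes. -/

section Counting

lemma encard_pair_le_two {α : Type*} (a b : α) : ({a, b} : Set α).encard ≤ 2 := by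
  refine (Set.encard_insert_le _ _).trans ?_
  rw [Set.encard_singleton]
  norm_num

lemma encard_biUnion_le {α β : Type*} {Y : Set α} (hY : Y.Finite) {f : α → Set β} {n : ℕ∞}
    (hf : ∀ y ∈ Y, (f y).encard ≤ n) : (⋃ y ∈ Y, f y).encard ≤ Y.encard * n := by
  induction Y, hY using Set.Finite.induction_on with
  | empty => simp
  | @insert a Y ha _ ih =>
    rw [Set.biUnion_insert, Set.encard_insert_of_notMem ha, add_mul, one_mul, add_comm]
    refine (Set.encard_union_le _ _).trans (add_le_add (hf a (Set.mem_insert _ _)) ?_)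
    exact ih fun y hy => hf y (Set.mem_insert_of_mem _ hy)

variable {V : Type*} {G : SimpleGraph V}

lemma encard_ladder_neighborSet_le {D : ℕ} (hD : ∀ v, (G.neighborSet v).encard ≤ D) (z : V × ℤ) :
    ((ladder G).neighborSet z).encard ≤ D + 2 := by
  obtain ⟨u, l⟩ := z
  have hsub : (ladder G).neighborSet (u, l) ⊆
      ((fun v => (v, l)) '' G.neighborSet u) ∪ {(u, l + 1), (u, l - 1)} := by
    rintro ⟨v, l'⟩ h
    rcases ladder_adj.1 h with ⟨h1, rfl⟩ | ⟨rfl, h1⟩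
    · exact Or.inl ⟨v, h1, rfl⟩
    · right
      rcases h1 with rfl | rfl
      · exact Or.inl rfl
      · right
        simp
  refine (Set.encard_le_encard hsub).trans ((Set.encard_union_le _ _).trans ?_)
  exact add_le_add ((Set.encard_image_le _ _).trans (hD u)) (encard_pair_le_two _ _)

lemma encard_touching_le {D : ℕ} (hD : ∀ v, (G.neighborSet v).encard ≤ D) {Y : Set (V × ℤ)}
    (hY : Y.Finite) : (touching G Y).encard ≤ Y.encard * (D + 2) := by
  have hsub : touching G Y ⊆ ⋃ y ∈ Y, (fun z => s(y, z)) '' (ladder G).neighborSet y := by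
    rintro e ⟨he, z, hz, hzY⟩
    obtain ⟨y, rfl⟩ := Sym2.mem_iff_exists.1 hz
    exact Set.mem_biUnion hzY ⟨y, he, rfl⟩
  exact (Set.encard_le_encard hsub).trans (encard_biUnion_le hY fun y _ =>
    (Set.encard_image_le _ _).trans (encard_ladder_neighborSet_le hD y))

lemma encard_prod_le {α β : Type*} {s : Set α} {t : Set β} {m n : ℕ} (hs : s.encard ≤ m)
    (ht : t.encard ≤ n) : (s ×ˢ t).encard ≤ (m * n : ℕ) := by
  rw [Set.encard_prod]
  push_cast
  exact mul_le_mul' hs ht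

lemma finite_touching {D : ℕ} (hD : ∀ v, (G.neighborSet v).encard ≤ D) {Y : Set (V × ℤ)}
    (hY : Y.Finite) : (touching G Y).Finite := by
  rw [← Set.encard_lt_top_iff]
  refine (encard_touching_le hD hY).trans_lt ?_
  obtain ⟨n, hn⟩ := hY.exists_encard_eq_coe
  rw [hn]
  exact_mod_cast ENat.natCast_lt_top (n * (D + 2))

lemma encard_boxVerts_le {D K : ℕ} (hD : ∀ v, (G.neighborSet v).encard ≤ D) {H : G.Subgraph}
    (hfin : H.verts.Finite) (hK : H.verts.encard ≤ K) (m : ℤ) :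
    (boxVerts H m).encard ≤ (K * (D + 1) * 2 : ℕ) := by
  have hsub : boxVerts H m ⊆ (⋃ u ∈ H.verts, insert u (G.neighborSet u)) ×ˢ {m, m + 1} := by
    rintro ⟨t, l⟩ ⟨hl, ht⟩
    refine ⟨?_, hl⟩
    rcases ht with ht | ⟨u, hu, ht⟩
    · exact Set.mem_biUnion ht (Set.mem_insert _ _)
    · exact Set.mem_biUnion hu (Set.mem_insert_of_mem _ ht)
  refine (Set.encard_le_encard hsub).trans (encard_prod_le ?_ (encard_pair_le_two _ _))
  refine (encard_biUnion_le (n := (D + 1 : ℕ)) hfin fun u _ => ?_).trans ?_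
  · refine (Set.encard_insert_le _ _).trans ?_
    push_cast
    exact add_le_add (hD u) le_rfl
  · push_cast
    exact mul_le_mul' hK le_rfl

lemma finite_boxVerts {D : ℕ} (hD : ∀ v, (G.neighborSet v).encard ≤ D) {H : G.Subgraph}
    (hfin : H.verts.Finite) (m : ℤ) : (boxVerts H m).Finite := by
  rw [← Set.encard_lt_top_iff]
  obtain ⟨n, hn⟩ := hfin.exists_encard_eq_coe
  exact (encard_boxVerts_le hD hfin hn.le m).trans_lt (ENat.natCast_lt_top _)

lemma encard_box_le {D K : ℕ} (hD : ∀ v, (G.neighborSet v).encard ≤ D) {H : G.Subgraph}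
    (hfin : H.verts.Finite) (hK : H.verts.encard ≤ K) (m : ℤ) :
    (box H m).encard ≤ (K * (D + 1) * 2 * (D + 2) : ℕ) := by
  refine (encard_touching_le hD (finite_boxVerts hD hfin m)).trans ?_
  push_cast
  have := encard_boxVerts_le hD hfin hK m
  push_cast at this
  exact mul_le_mul' this le_rfl

/-- An edge lies in the boxes around a bounded number of inner edges. -/
lemma encard_setOf_mem_box_le {D K : ℕ} (hD : ∀ v, (G.neighborSet v).encard ≤ D)
    {H : ℕ → G.Subgraph} (hHfin : ∀ r, (H r).verts.Finite) (hK : ∀ r, (H r).verts.encard ≤ K)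
    (hH : ∀ i j, i ≠ j → 3 ≤ setDist G (H i).verts (H j).verts) (f : Sym2 (V × ℤ)) :
    {e | ∃ r m, f ∈ box (H r) m ∧ e ∈ touching G ((H r).verts ×ˢ {m, m + 1})}.encard ≤
      (2 * (K * 3 * (D + 2)) : ℕ) := by
  have key : ∀ y : V × ℤ,
      {e | ∃ r m, y ∈ boxVerts (H r) m ∧ e ∈ touching G ((H r).verts ×ˢ {m, m + 1})}.encard ≤
        (K * 3 * (D + 2) : ℕ) := by
    intro y
    by_cases hy : ∃ r m, y ∈ boxVerts (H r) m
    · obtain ⟨r, m, hrm⟩ := hy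
      -- The vertex `y` determines `r`, and `m` is `y.2 - 1` or `y.2`, so these three levels cover
      -- every possible pair.
      set Y : Set (V × ℤ) := (H r).verts ×ˢ {y.2 - 1, y.2, y.2 + 1} with hYdef
      have hYfin : Y.Finite := (hHfin r).prod (Set.toFinite _)
      have hYcard : Y.encard ≤ (K * 3 : ℕ) := by
        refine encard_prod_le (hK r) ?_
        refine (Set.encard_insert_le _ _).trans ?_
        refine (add_le_add (encard_pair_le_two _ _) le_rfl).trans ?_
        norm_num
      have hsub : {e | ∃ r m, y ∈ boxVerts (H r) m ∧
          e ∈ touching G ((H r).verts ×ˢ {m, m + 1})} ⊆ touching G Y := by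
        rintro e ⟨r', m', hy', he, z, hze, hz, hz'⟩
        obtain rfl := eq_of_mem_boxVerts hH rfl hrm hy'
        refine ⟨he, z, hze, hz, ?_⟩
        have h1 := hy'.1
        simp only [Set.mem_insert_iff, Set.mem_singleton_iff] at hz' ⊢
        omega
      refine (Set.encard_le_encard hsub).trans ((encard_touching_le hD hYfin).trans ?_)
      rw [Nat.cast_mul]
      exact mul_le_mul' hYcard (by push_cast; exact le_rfl)
    · have : {e | ∃ r m, y ∈ boxVerts (H r) m ∧
          e ∈ touching G ((H r).verts ×ˢ {m, m + 1})} = ∅ := by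
        rw [Set.eq_empty_iff_forall_notMem]
        rintro e ⟨r, m, h, -⟩
        exact hy ⟨r, m, h⟩
      rw [this]
      simp
  induction f using Sym2.ind with
  | _ y y' =>
  have hsub : {e | ∃ r m, s(y, y') ∈ box (H r) m ∧
      e ∈ touching G ((H r).verts ×ˢ {m, m + 1})} ⊆
      {e | ∃ r m, y ∈ boxVerts (H r) m ∧ e ∈ touching G ((H r).verts ×ˢ {m, m + 1})} ∪
      {e | ∃ r m, y' ∈ boxVerts (H r) m ∧ e ∈ touching G ((H r).verts ×ˢ {m, m + 1})} := by
    rintro e ⟨r, m, hf, he⟩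
    rcases (mem_touching.1 hf).2 with h | h
    · exact Or.inl ⟨r, m, h, he⟩
    · exact Or.inr ⟨r, m, h, he⟩
  refine (Set.encard_le_encard hsub).trans ((Set.encard_union_le _ _).trans ?_)
  rw [two_mul, Nat.cast_add]
  exact add_le_add (key y) (key y')

end Counting

/-! ### Comparison of escape probabilities in a finite cylinder. -/

section FiniteVolume

variable {V : Type*} {G : SimpleGraph V}

/-- The open edges of a configuration. -/
def openEdges (ω : Config G) : Set (Sym2 (V × ℤ)) :=
  {e | ∃ h : e ∈ (ladder G).edgeSet, ω ⟨e, h⟩ = true}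

/-- The open edges of a configuration on a finite set of edges. -/
def openEdgesOn {F : Finset (ladder G).edgeSet} (η : F → Bool) : Set (Sym2 (V × ℤ)) :=
  {e | ∃ (h : e ∈ (ladder G).edgeSet) (h' : ⟨e, h⟩ ∈ F), η ⟨⟨e, h⟩, h'⟩ = true}

lemma bernoulliMeasure_singleton (a : I) (b : Bool) :
    bernoulliMeasure true false a {b} = ENNReal.ofReal (bernWeight a b) := by
  rw [bernoulliMeasure_apply a (measurableSet_singleton b)]
  cases b
  · simp only [bernWeight, cond_false, Set.mem_singleton_iff, reduceCtorEq, if_true, if_false]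
    rw [← unitInterval.coe_symm_eq, ENNReal.ofReal, Real.toNNReal_of_nonneg (unitInterval.symm a).2.1]
    rfl
  · simp only [bernWeight, cond_true, Set.mem_singleton_iff, reduceCtorEq, if_true, if_false]
    rw [ENNReal.ofReal, Real.toNNReal_of_nonneg a.2.1]
    rfl

open Classical in
lemma pi_bernoulliMeasure_apply {α : Type*} [Fintype α] (x : α → I) (A : Set (α → Bool)) :
    Measure.pi (fun e => bernoulliMeasure true false (x e)) A =
      ENNReal.ofReal (cfgProb (fun e => (x e : ℝ)) A) := by
  have hb : ∀ (a : I) (b : Bool), 0 ≤ bernWeight a b := by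
    intro a b
    cases b
    · exact sub_nonneg.2 a.2.2
    · exact a.2.1
  have hw : ∀ ω, 0 ≤ cfgWeight (fun e => (x e : ℝ)) ω := fun ω =>
    Finset.prod_nonneg fun e _ => hb _ _
  have hA : A = ((Finset.univ.filter (· ∈ A) : Finset (α → Bool)) : Set (α → Bool)) := by
    ext; simp
  conv_lhs => rw [hA, ← sum_measure_singleton]
  rw [cfgProb, ← Finset.sum_filter, ENNReal.ofReal_sum_of_nonneg fun ω _ => hw ω]
  refine Finset.sum_congr rfl fun ω _ => ?_
  rw [Measure.pi_singleton, cfgWeight, ENNReal.ofReal_prod_of_nonneg fun e _ => hb _ _]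
  exact Finset.prod_congr rfl fun e _ => bernoulliMeasure_singleton _ _

lemma escapes_openEdges_iff {W : Set (V × ℤ)} {x : V × ℤ} {F : Finset (ladder G).edgeSet}
    (hF : ∀ e : (ladder G).edgeSet, (∃ z ∈ (e : Sym2 (V × ℤ)), z ∈ W) → e ∈ F) (ω : Config G) :
    Escapes W x (openEdges ω) ↔ Escapes W x (openEdgesOn (F.restrict ω)) := by
  constructor
  · refine Escapes.of_touching ?_
    rintro e ⟨he, hω⟩ hz
    exact ⟨he, hF ⟨e, he⟩ hz, hω⟩
  · refine Escapes.mono ?_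
    rintro e ⟨he, _, hω⟩
    exact ⟨he, hω⟩

lemma percLaw_escapes {W : Set (V × ℤ)} {x : V × ℤ} {F : Finset (ladder G).edgeSet}
    (hF : ∀ e : (ladder G).edgeSet, (∃ z ∈ (e : Sym2 (V × ℤ)), z ∈ W) → e ∈ F)
    (H : ℕ → G.Subgraph) (q p : I) [DecidableEq F] :
    MeasurableSet {ω : Config G | Escapes W x (openEdges ω)} ∧
    percLaw H q p {ω : Config G | Escapes W x (openEdges ω)} =
      ENNReal.ofReal (cfgProb (fun e : F => (edgeParam H q p e : ℝ))
        {η | Escapes W x (openEdgesOn η)}) := by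
  have hpre : {ω : Config G | Escapes W x (openEdges ω)} =
      F.restrict ⁻¹' {η : F → Bool | Escapes W x (openEdgesOn η)} := by
    ext ω
    exact escapes_openEdges_iff hF ω
  have hmeas : MeasurableSet {η : F → Bool | Escapes W x (openEdgesOn η)} :=
    (Set.toFinite _).measurableSet
  have hr : Measurable (F.restrict : Config G → (F → Bool)) := Finset.measurable_restrict F
  rw [hpre]
  refine ⟨hr hmeas, ?_⟩
  rw [← Measure.map_apply hr hmeas, percLaw, Measure.infinitePi_map_restrict,
    pi_bernoulliMeasure_apply]
  congr!

lemma isUpperSet_escapes {W : Set (V × ℤ)} {x : V × ℤ} {F : Finset (ladder G).edgeSet} :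
    IsUpperSet {η : F → Bool | Escapes W x (openEdgesOn η)} := by
  intro η η' h hη
  refine Escapes.mono ?_ hη
  rintro e ⟨he, he', h1⟩
  refine ⟨he, he', ?_⟩
  have := h ⟨⟨e, he⟩, he'⟩
  rw [h1] at this
  exact eq_top_iff.2 this

lemma openEdgesOn_update_true {F : Finset (ladder G).edgeSet} [DecidableEq F] (η : F → Bool)
    (e : F) : openEdgesOn (Function.update η e true) = openEdgesOn η ∪ {(e : Sym2 (V × ℤ))} := by
  obtain ⟨⟨e, he⟩, heF⟩ := e
  ext g
  constructor
  · rintro ⟨h, h', h1⟩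
    by_cases hg : g = e
    · exact Or.inr hg
    · rw [Function.update_of_ne (by simpa using hg)] at h1
      exact Or.inl ⟨h, h', h1⟩
  · rintro (⟨h, h', h1⟩ | hg)
    · refine ⟨h, h', ?_⟩
      by_cases hg : g = e
      · subst hg; simp
      · rw [Function.update_of_ne (by simpa using hg), h1]
    · rw [Set.mem_singleton_iff] at hg
      subst hg
      exact ⟨he, heF, by simp⟩

lemma openEdgesOn_update_false {F : Finset (ladder G).edgeSet} [DecidableEq F] (η : F → Bool)
    (e : F) : openEdgesOn (Function.update η e false) = openEdgesOn η \ {(e : Sym2 (V × ℤ))} := by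
  obtain ⟨⟨e, he⟩, heF⟩ := e
  ext g
  constructor
  · rintro ⟨h, h', h1⟩
    by_cases hg : g = e
    · subst hg; simp at h1
    · rw [Function.update_of_ne (by simpa using hg)] at h1
      exact ⟨⟨h, h', h1⟩, hg⟩
  · rintro ⟨⟨h, h', h1⟩, hg⟩
    refine ⟨h, h', ?_⟩
    rw [Function.update_of_ne (by simpa using hg), h1]

open Classical in
/-- Comparison of the probabilities to escape from a finite cylinder over a set `W₀`
which contains or avoids each of the sets of vertices of the `H r`. -/
theorem percLaw_escapes_le [Infinite V] (hconn : G.Connected) {D K : ℕ}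
    (hD : ∀ v, (G.neighborSet v).encard ≤ D) {H : ℕ → G.Subgraph}
    (hHfin : ∀ r, (H r).verts.Finite) (hHconn : ∀ r, (H r).Connected)
    (hH : ∀ i j, i ≠ j → 3 ≤ setDist G (H i).verts (H j).verts)
    (hK : ∀ r, (H r).verts.encard ≤ K) {W₀ : Set V} (hW₀ : W₀.Finite)
    (hsat : ∀ r, ∀ u ∈ (H r).verts, u ∈ W₀ → (H r).verts ⊆ W₀) {N : ℤ} (hN : 1 ≤ N)
    {x : V × ℤ} (hx : x.1 ∉ ⋃ r, (H r).verts)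
    {p q ε δ c : ℝ} (hc : 0 < c) (hδ : 0 ≤ δ) (hε : 0 ≤ ε)
    (hδε : δ * ((2 / c) ^ (K * (D + 1) * 2 * (D + 2)) * (2 * (K * 3 * (D + 2)) : ℕ)) ≤ ε)
    (hp : c ≤ p - ε ∧ p + ε ≤ 1 - c) (hq : c ≤ q - δ ∧ q + δ ≤ 1 - c)
    {q₁ p₁ q₂ p₂ : I} (hq₁ : (q₁ : ℝ) = q + δ) (hp₁ : (p₁ : ℝ) = p - ε) (hq₂ : (q₂ : ℝ) = q - δ)
    (hp₂ : (p₂ : ℝ) = p + ε) :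
    MeasurableSet {ω : Config G | Escapes (W₀ ×ˢ Set.Icc (-N) N) x (openEdges ω)} ∧
    percLaw H q₁ p₁ {ω | Escapes (W₀ ×ˢ Set.Icc (-N) N) x (openEdges ω)} ≤
      percLaw H q₂ p₂ {ω | Escapes (W₀ ×ˢ Set.Icc (-N) N) x (openEdges ω)} := by
  set W : Set (V × ℤ) := W₀ ×ˢ Set.Icc (-N) N with hWdef
  have hWfin : W.Finite := hW₀.prod (Set.finite_Icc _ _)
  -- Edges touching `W` determine the event, but the surgery also uses box edges above neighbours of
  -- `H r`, which may lie outside `W`.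
  set Y : Set (V × ℤ) := W ∪ ⋃ y ∈ W, (ladder G).neighborSet y with hYdef
  have hYfin : Y.Finite := by
    refine hWfin.union (hWfin.biUnion fun y _ => ?_)
    rw [← Set.encard_lt_top_iff]
    exact (encard_ladder_neighborSet_le hD y).trans_lt (by exact_mod_cast ENat.natCast_lt_top (D + 2))
  obtain ⟨F, hFmem⟩ : ∃ F : Finset (ladder G).edgeSet,
      ∀ e : (ladder G).edgeSet, e ∈ F ↔ (e : Sym2 (V × ℤ)) ∈ touching G Y := by
    have := (finite_touching hD hYfin).preimage
      (f := fun e : (ladder G).edgeSet => (e : Sym2 (V × ℤ))) Subtype.val_injective.injOn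
    exact ⟨this.toFinset, fun e => by simp⟩
  have hFW : ∀ e : (ladder G).edgeSet, (∃ z ∈ (e : Sym2 (V × ℤ)), z ∈ W) → e ∈ F := by
    rintro e ⟨z, hz, hzW⟩
    exact (hFmem e).2 ⟨e.2, z, hz, Or.inl hzW⟩
  have hbox : ∀ r m, (∀ u ∈ (H r).verts, (u, m) ∈ W ∧ (u, m + 1) ∈ W) →
      ∀ e : (ladder G).edgeSet, (e : Sym2 (V × ℤ)) ∈ box (H r) m → e ∈ F := by
    rintro r m hrm e ⟨he, ⟨t, l⟩, hz, hl, hzY⟩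
    refine (hFmem e).2 ⟨e.2, ⟨t, l⟩, hz, ?_⟩
    dsimp only at hl hzY
    have hin : ∀ u ∈ (H r).verts, (u, l) ∈ W := by
      intro u hu
      rcases hl with rfl | rfl
      exacts [(hrm u hu).1, (hrm u hu).2]
    rcases hzY with h | ⟨u, hu, h⟩
    · exact Or.inl (hin t h)
    · exact Or.inr (Set.mem_biUnion (hin u hu) (ladder_adj.2 (Or.inl ⟨h, rfl⟩)))
  -- around each inner edge which touches `W` there is a box with interior inside `W`
  have hcentre : ∀ e : Sym2 (V × ℤ), ∃ r m, e ∈ ⋃ r, inEdges (H r) →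
      e ∈ (ladder G).edgeSet → (∃ z ∈ e, z ∈ W) →
      (∀ u ∈ (H r).verts, (u, m) ∈ W ∧ (u, m + 1) ∈ W) ∧
        e ∈ touching G ((H r).verts ×ˢ {m, m + 1}) := by
    intro e
    by_cases hcond : e ∈ ⋃ r, inEdges (H r) ∧ ∃ z ∈ e, z ∈ W
    swap
    -- A dummy centre for irrelevant edges, so that the choice below depends on `e` alone.
    · exact ⟨0, 0, fun h1 _ h2 => absurd ⟨h1, h2⟩ hcond⟩
    obtain ⟨hin, ⟨u, l⟩, hz, hzW₀, hzN⟩ := hcond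
    obtain ⟨r, hr⟩ := Set.mem_iUnion.1 hin
    have hu : u ∈ (H r).verts := by
      rcases hr with ⟨a, b, n, hab, rfl⟩ | ⟨a, n, ha, rfl⟩
      · rcases Sym2.mem_iff.1 hz with h | h <;> rw [Prod.mk.injEq] at h <;> rw [h.1]
        exacts [hab.fst_mem, hab.snd_mem]
      · rcases Sym2.mem_iff.1 hz with h | h <;> rw [Prod.mk.injEq] at h <;> rw [h.1] <;> exact ha
    dsimp only at hzW₀ hzN
    rw [Set.mem_Icc] at hzN
    -- On the top level the box is shifted down by one to keep both levels inside `W`; this needs `1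
    -- ≤ N`.
    obtain ⟨m, hm, hm1, hm2⟩ : ∃ m, (l = m ∨ l = m + 1) ∧ -N ≤ m ∧ m + 1 ≤ N := by
      by_cases h : l < N
      · exact ⟨l, by omega⟩
      · exact ⟨l - 1, by omega⟩
    refine ⟨r, m, fun _ hlad _ => ⟨fun u' hu' => ?_, hlad, (u, l), hz, hu, by simpa using hm⟩⟩
    have hu'W := hsat r u hu hzW₀ hu'
    exact ⟨⟨hu'W, Set.mem_Icc.2 ⟨hm1, by omega⟩⟩, ⟨hu'W, Set.mem_Icc.2 ⟨by omega, hm2⟩⟩⟩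
  choose ρ μ hρμ using hcentre
  set A : Set (F → Bool) := {η | Escapes W x (openEdgesOn η)} with hA
  set S : Finset F := Finset.univ.filter fun e => (e : Sym2 (V × ℤ)) ∈ ⋃ r, inEdges (H r) with hSdef
  set B : F → Finset F := fun e => if ∃ z ∈ (e : Sym2 (V × ℤ)), z ∈ W then
    Finset.univ.filter fun f => (f : Sym2 (V × ℤ)) ∈ box (H (ρ e)) (μ e) else ∅ with hBdef
  have hinj : Function.Injective fun e : F => (e : Sym2 (V × ℤ)) := fun _ _ h =>
    Subtype.ext (Subtype.ext h)
  have hcard : ∀ (s : Finset F) (t : Set (Sym2 (V × ℤ))) (n : ℕ),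
      (∀ e ∈ s, (e : Sym2 (V × ℤ)) ∈ t) → t.encard ≤ n → s.card ≤ n := by
    intro s t n hst ht
    have h1 : ((fun e : F => (e : Sym2 (V × ℤ))) '' (s : Set F)).encard ≤ n :=
      (Set.encard_le_encard (by rintro _ ⟨e, he, rfl⟩; exact hst e he)).trans ht
    rw [hinj.encard_image, Set.encard_coe_eq_coe_finsetCard] at h1
    exact_mod_cast h1
  have hmemB : ∀ e f, f ∈ B e → (∃ z ∈ (e : Sym2 (V × ℤ)), z ∈ W) ∧
      (f : Sym2 (V × ℤ)) ∈ box (H (ρ e)) (μ e) := by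
    intro e f hf
    by_cases he : ∃ z ∈ (e : Sym2 (V × ℤ)), z ∈ W
    · refine ⟨he, ?_⟩
      simp only [B, if_pos he, Finset.mem_filter] at hf
      exact hf.2
    · simp only [B, if_neg he, Finset.notMem_empty] at hf
  have hSmem : ∀ e : F, e ∈ S ↔ (e : Sym2 (V × ℤ)) ∈ ⋃ r, inEdges (H r) := by
    intro e
    simp [S]
  have hmain := cfgProb_le_of_transfer (isUpperSet_escapes (W := W) (x := x) (F := F)) S B
    (M := K * (D + 1) * 2 * (D + 2)) (N := 2 * (K * 3 * (D + 2))) hc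
    (fun e he => hcard _ _ _ (fun f hf => (hmemB e f hf).2)
      (encard_box_le hD (hHfin _) (hK _) _))
    (fun f => hcard _ _ _ (fun e he => by
      obtain ⟨heS, hef⟩ := Finset.mem_filter.1 he
      obtain ⟨h1, h2⟩ := hmemB e f hef
      exact ⟨ρ e, μ e, h2, (hρμ e ((hSmem e).1 heS) e.1.2 h1).2⟩)
      (encard_setOf_mem_box_le hD hHfin hK hH (f : Sym2 (V × ℤ)))) ?_ hδ hε hδε hp hq
  · have hparam : ∀ (q' p' : I) (a b : ℝ), (q' : ℝ) = a → (p' : ℝ) = b →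
        (fun e : F => (edgeParam H q' p' e : ℝ)) = fun e => if e ∈ S then a else b := by
      rintro q' p' a b rfl rfl
      ext e
      by_cases he : e ∈ S
      · rw [if_pos he, edgeParam, if_pos ((hSmem e).1 he)]
      · rw [if_neg he, edgeParam, if_neg fun h => he ((hSmem e).2 h)]
    obtain ⟨hmeas, h1⟩ := percLaw_escapes (x := x) hFW H q₁ p₁
    obtain ⟨-, h2⟩ := percLaw_escapes (x := x) hFW H q₂ p₂
    refine ⟨hmeas, ?_⟩
    rw [h1, h2, hparam q₁ p₁ _ _ hq₁ hp₁, hparam q₂ p₂ _ _ hq₂ hp₂]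
    exact ENNReal.ofReal_le_ofReal hmain
  · intro e he η hη
    obtain ⟨h₁, h₀⟩ := hη
    rw [Set.mem_ofPred_eq, openEdgesOn_update_true] at h₁
    rw [Set.mem_ofPred_eq, openEdgesOn_update_false] at h₀
    have hin := (hSmem e).1 he
    -- An edge that does not touch `W` is never pivotal, so its empty `B e` does no harm.
    have htouch : ∃ z ∈ (e : Sym2 (V × ℤ)), z ∈ W := by
      by_contra hcon
      refine h₀ (h₁.of_touching ?_)
      rintro g (hg | hg) hgW
      · refine ⟨hg, fun hge => hcon ?_⟩
        rw [Set.mem_singleton_iff] at hge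
        rwa [← hge]
      · rw [Set.mem_singleton_iff] at hg
        rw [hg] at hgW
        exact absurd hgW hcon
    obtain ⟨hW', het⟩ := hρμ e hin e.1.2 htouch
    have hebox : (e : Sym2 (V × ℤ)) ∈ box (H (ρ e)) (μ e) := by
      obtain ⟨h1, z, h2, h3, h4⟩ := het
      exact ⟨h1, z, h2, by simpa using h4, Or.inl h3⟩
    obtain ⟨f, hf, hfin, S', hS', hf₁, hf₀⟩ := exists_outer_decisive_edge hconn hHfin hHconn hH hW'
      (fun h => hx (Set.mem_iUnion.2 ⟨_, h⟩)) (finite_touching hD (finite_boxVerts hD (hHfin _) _))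
      (fun g hg => hg.1) hebox h₁ h₀
    have hfF := hbox _ _ hW' ⟨f, hf.1⟩ hf
    -- No edge of `S'` is lost: inside the box `F` contains every edge, and outside it `S'` agrees
    -- with the open edges of `η`.
    set η' : F → Bool := fun g => decide ((g : Sym2 (V × ℤ)) ∈ S') with hη'
    have hopen : openEdgesOn η' = S' := by
      ext g
      constructor
      · rintro ⟨h, h', h1⟩
        exact of_decide_eq_true h1
      · intro hg
        by_cases hgB : g ∈ box (H (ρ e)) (μ e)
        · exact ⟨hgB.1, hbox _ _ hW' ⟨g, hgB.1⟩ hgB, decide_eq_true hg⟩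
        · obtain ⟨h, h', -⟩ := (hS' g hgB).1 hg
          exact ⟨h, h', decide_eq_true hg⟩
    refine ⟨⟨⟨f, hf.1⟩, hfF⟩, ?_, η', ⟨?_, ?_⟩, ?_⟩
    · rw [Finset.mem_sdiff, hSmem]
      refine ⟨?_, hfin⟩
      simp only [B, if_pos htouch]
      exact Finset.mem_filter.2 ⟨Finset.mem_univ _, hf⟩
    · rw [Set.mem_ofPred_eq, openEdgesOn_update_true, hopen]
      exact hf₁
    · rw [Set.mem_ofPred_eq, openEdgesOn_update_false, hopen]
      exact hf₀
    · intro g hg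
      have hgB : (g : Sym2 (V × ℤ)) ∉ box (H (ρ e)) (μ e) := by
        intro h
        refine hg ?_
        simp only [B, if_pos htouch]
        exact Finset.mem_filter.2 ⟨Finset.mem_univ _, h⟩
      have h1 := hS' _ hgB
      have h2 : (g : Sym2 (V × ℤ)) ∈ openEdgesOn η ↔ η g = true :=
        ⟨fun ⟨_, _, h⟩ => h, fun h => ⟨g.1.2, g.2, h⟩⟩
      rw [Bool.eq_iff_iff, ← h2, ← h1]
      exact decide_eq_true_iff

end FiniteVolume

/-! ### Exhaustion by finite saturated cylinders. -/

section Exhaustion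

variable {V : Type*}

/-- The vertices at distance at most `n` from `v`. -/
def graphBall (G : SimpleGraph V) (v : V) : ℕ → Set V
  | 0 => {v}
  | n + 1 => graphBall G v n ∪ ⋃ u ∈ graphBall G v n, G.neighborSet u

/-- The ball, enlarged by the vertex sets of the subgraphs `H r` which it meets. -/
def saturatedBall (G : SimpleGraph V) (H : ℕ → G.Subgraph) (v : V) (n : ℕ) : Set V :=
  graphBall G v n ∪ ⋃ u ∈ graphBall G v n, {t | ∃ r, u ∈ (H r).verts ∧ t ∈ (H r).verts}

variable {G : SimpleGraph V}

lemma finite_graphBall {D : ℕ} (hD : ∀ v, (G.neighborSet v).encard ≤ D) (v : V) (n : ℕ) :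
    (graphBall G v n).Finite := by
  induction n with
  | zero => exact Set.finite_singleton v
  | succ n ih =>
    refine ih.union (ih.biUnion fun u _ => ?_)
    rw [← Set.encard_lt_top_iff]
    exact (hD u).trans_lt (ENat.natCast_lt_top D)

lemma monotone_graphBall (v : V) : Monotone (graphBall G v) :=
  monotone_nat_of_le_succ fun _ => Set.subset_union_left

lemma exists_mem_graphBall (hconn : G.Connected) (v u : V) : ∃ n, u ∈ graphBall G v n := by
  obtain ⟨p⟩ := hconn.preconnected v u
  induction p using SimpleGraph.Walk.concatRec with
  | Hnil => exact ⟨0, rfl⟩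
  | Hconcat p h ih =>
    obtain ⟨n, hn⟩ := ih
    exact ⟨n + 1, Or.inr (Set.mem_biUnion hn h)⟩

lemma eq_of_mem_verts {H : ℕ → G.Subgraph}
    (hH : ∀ i j, i ≠ j → 3 ≤ setDist G (H i).verts (H j).verts) {i j : ℕ} {u : V}
    (hi : u ∈ (H i).verts) (hj : u ∈ (H j).verts) : i = j :=
  eq_of_walk_length_le_two hH hi hj .nil (by simp)

lemma finite_saturatedBall {D : ℕ} (hD : ∀ v, (G.neighborSet v).encard ≤ D) {H : ℕ → G.Subgraph}
    (hHfin : ∀ r, (H r).verts.Finite)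
    (hH : ∀ i j, i ≠ j → 3 ≤ setDist G (H i).verts (H j).verts) (v : V) (n : ℕ) :
    (saturatedBall G H v n).Finite := by
  refine (finite_graphBall hD v n).union ((finite_graphBall hD v n).biUnion fun u _ => ?_)
  by_cases hu : ∃ r, u ∈ (H r).verts
  · obtain ⟨r, hr⟩ := hu
    refine (hHfin r).subset ?_
    rintro t ⟨s, hs, ht⟩
    rwa [eq_of_mem_verts hH hr hs]
  · refine Set.finite_empty.subset ?_
    rintro t ⟨s, hs, -⟩
    exact hu ⟨s, hs⟩

lemma monotone_saturatedBall (H : ℕ → G.Subgraph) (v : V) : Monotone (saturatedBall G H v) :=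
  fun _ _ h => Set.union_subset_union (monotone_graphBall v h)
    (Set.biUnion_subset_biUnion_left (monotone_graphBall v h))

/-- Distinct subgraphs are disjoint, so vertices added by saturation meet no further subgraph and
one round suffices. -/
lemma verts_subset_saturatedBall {H : ℕ → G.Subgraph}
    (hH : ∀ i j, i ≠ j → 3 ≤ setDist G (H i).verts (H j).verts) (v : V) (n : ℕ) (r : ℕ) (u : V)
    (hu : u ∈ (H r).verts) (h : u ∈ saturatedBall G H v n) :
    (H r).verts ⊆ saturatedBall G H v n := by
  intro t ht
  rcases h with h | h
  · exact Or.inr (Set.mem_biUnion h ⟨r, hu, ht⟩)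
  · obtain ⟨w, hw, s, hws, hus⟩ := Set.mem_iUnion₂.1 h
    obtain rfl := eq_of_mem_verts hH hu hus
    exact Or.inr (Set.mem_biUnion hw ⟨r, hws, ht⟩)

/-- The cluster is infinite when it leaves every set of an exhaustion by finite sets. -/
lemma percolates_eq_iInter {W : ℕ → Set (V × ℤ)} (hfin : ∀ n, (W n).Finite) (hmono : Monotone W)
    (hex : ∀ z, ∃ n, z ∈ W n) (x : V × ℤ) :
    percolates G x = ⋂ n, {ω | Escapes (W n) x (openEdges ω)} := by
  ext ω
  rw [Set.mem_iInter]
  constructor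
  · intro h n
    obtain ⟨y, hy, hyW⟩ := Set.Infinite.exists_notMem_finite h (hfin n)
    exact ⟨y, hyW, hy⟩
  · intro h hcl
    choose ν hν using hex
    -- At this stage `W` contains the whole cluster, supposed finite.
    obtain ⟨y, hy, hr⟩ := h (hcl.toFinset.sup ν)
    have hyc : y ∈ hcl.toFinset := hcl.mem_toFinset.2 hr
    exact hy (hmono (Finset.le_sup hyc) (hν y))

end Exhaustion

end LadderPercolation

/-! ### Choice of constants and passage to infinite volume. -/

open LadderPercolation

theorem proposition2 {V : Type*} [Infinite V] (G : SimpleGraph V) (hconn : G.Connected)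
    (hdeg : LadderPercolation.BoundedDegree G)
    (H : ℕ → G.Subgraph)
    (hHfin : ∀ r, (H r).verts.Finite)
    (hHconn : ∀ r, (H r).Connected)
    (hHdist : ∀ i j, i ≠ j → 3 ≤ LadderPercolation.setDist G (H i).verts (H j).verts)
    (hHcard : ∃ K : ℕ, ∀ r, (H r).verts.ncard ≤ K)
    (p q : ℝ) (hp : p ∈ Set.Ioo (0 : ℝ) 1) (hq : q ∈ Set.Ioo (0 : ℝ) 1)
    (ε : ℝ) (hε : ε ∈ Set.Ioo (0 : ℝ) (min p (1 - p))) :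
    ∃ η : ℝ, 0 < η ∧ ∀ δ ∈ Set.Ioo (0 : ℝ) η,
      ∃ (hq₁ : q + δ ∈ Set.Icc (0 : ℝ) 1) (hp₁ : p - ε ∈ Set.Icc (0 : ℝ) 1)
        (hq₂ : q - δ ∈ Set.Icc (0 : ℝ) 1) (hp₂ : p + ε ∈ Set.Icc (0 : ℝ) 1),
        ∀ v : V, v ∉ ⋃ r, (H r).verts →
          LadderPercolation.percLaw H ⟨q + δ, hq₁⟩ ⟨p - ε, hp₁⟩
              (LadderPercolation.percolates G (v, 0)) ≤
            LadderPercolation.percLaw H ⟨q - δ, hq₂⟩ ⟨p + ε, hp₂⟩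
              (LadderPercolation.percolates G (v, 0)) := by
  obtain ⟨D, hD⟩ := hdeg
  obtain ⟨K, hK⟩ := hHcard
  obtain ⟨hε0, hεmin⟩ := hε
  obtain ⟨hεp, hεp'⟩ := lt_min_iff.1 hεmin
  have hK' : ∀ r, (H r).verts.encard ≤ K := fun r => by
    rw [← (hHfin r).cast_ncard_eq]
    exact_mod_cast hK r
  -- All parameters on the segment must stay in `[c, 1 - c]`; the halves leave room for `δ < c`
  -- around `q`.
  obtain ⟨c, hc, hcp, hcp', hcq, hcq'⟩ : ∃ c : ℝ, 0 < c ∧ c ≤ p - ε ∧ c ≤ 1 - p - ε ∧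
      c ≤ q / 2 ∧ c ≤ (1 - q) / 2 := by
    refine ⟨min (min (p - ε) (1 - p - ε)) (min (q / 2) ((1 - q) / 2)), ?_,
      (min_le_left _ _).trans (min_le_left _ _), (min_le_left _ _).trans (min_le_right _ _),
      (min_le_right _ _).trans (min_le_left _ _), (min_le_right _ _).trans (min_le_right _ _)⟩
    refine lt_min (lt_min ?_ ?_) (lt_min ?_ ?_) <;> linarith [hq.1, hq.2]
  set C : ℝ := (2 / c) ^ (K * (D + 1) * 2 * (D + 2)) * (2 * (K * 3 * (D + 2)) : ℕ) with hC
  have hC0 : 0 ≤ C := by positivity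
  -- `C` depends on `c`, `K` and `D` only, hence neither on `v` nor on the cylinder; `C + 1` is
  -- positive even if `C` vanishes.
  refine ⟨min c (ε / (C + 1)), lt_min hc (by positivity), fun δ ⟨hδ0, hδ⟩ => ?_⟩
  obtain ⟨hδc, hδC⟩ := lt_min_iff.1 hδ
  rw [lt_div_iff₀ (by positivity)] at hδC
  have hδε : δ * C ≤ ε := by nlinarith
  refine ⟨⟨by linarith [hq.1], by linarith⟩, ⟨by linarith, by linarith [hp.2]⟩,
    ⟨by linarith, by linarith [hq.2]⟩, ⟨by linarith [hp.1], by linarith⟩, fun v hv => ?_⟩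
  -- The half-height is `n + 1` because the finite-volume comparison needs at least 1.
  set W : ℕ → Set (V × ℤ) := fun n =>
    saturatedBall G H v n ×ˢ Set.Icc (-((n : ℤ) + 1)) ((n : ℤ) + 1) with hW
  have hWmono : Monotone W := fun m n hmn => Set.prod_mono (monotone_saturatedBall H v hmn)
    (Set.Icc_subset_Icc (by omega) (by omega))
  have hfinite : ∀ n, (W n).Finite := fun n =>
    (finite_saturatedBall hD hHfin hHdist v n).prod (Set.finite_Icc _ _)
  have hex : ∀ z, ∃ n, z ∈ W n := by
    rintro ⟨u, l⟩
    obtain ⟨n, hn⟩ := exists_mem_graphBall hconn v u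
    refine ⟨max n l.natAbs, Or.inl (monotone_graphBall v (le_max_left _ _) hn), ?_⟩
    rw [Set.mem_Icc]
    dsimp only
    omega
  have hanti : Antitone fun n => {ω : Config G | Escapes (W n) (v, 0) (openEdges ω)} := by
    rintro m n hmn ω ⟨y, hy, hr⟩
    exact ⟨y, fun h => hy (hWmono hmn h), hr⟩
  have hstep := fun n : ℕ => percLaw_escapes_le hconn hD hHfin hHconn hHdist hK'
    (finite_saturatedBall hD hHfin hHdist v n) (verts_subset_saturatedBall hHdist v n)
    (N := (n : ℤ) + 1) (by omega) (x := (v, 0)) hv hc hδ0.le hε0.le hδε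
    ⟨hcp, by linarith⟩ (p := p) (q := q) ⟨by linarith, by linarith⟩
    (q₁ := ⟨q + δ, by linarith [hq.1], by linarith⟩)
    (p₁ := ⟨p - ε, by linarith, by linarith [hp.2]⟩)
    (q₂ := ⟨q - δ, by linarith, by linarith [hq.2]⟩)
    (p₂ := ⟨p + ε, by linarith [hp.1], by linarith⟩) rfl rfl rfl rfl
  rw [percolates_eq_iInter hfinite hWmono hex]
  have hlim : ∀ q' p' : I, Filter.Tendsto
      (fun n => percLaw H q' p' {ω | Escapes (W n) (v, 0) (openEdges ω)}) Filter.atTop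
      (nhds (percLaw H q' p' (⋂ n, {ω | Escapes (W n) (v, 0) (openEdges ω)}))) := by
    intro q' p'
    have : IsProbabilityMeasure (percLaw H q' p') := by unfold percLaw; infer_instance
    exact tendsto_measure_iInter_atTop (fun n => (hstep n).1.nullMeasurableSet) hanti
      ⟨0, measure_ne_top _ _⟩
  exact le_of_tendsto_of_tendsto' (hlim _ _) (hlim _ _) fun n => (hstep n).2
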